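/- Let $R$ be a commutative ring with unit and let $E=(E^0,E^1,r,s)$ be an arbitrary directed graph. Paths are finite sequences of edges $\mu=e_1\cdots e_n$ with $r(e_i)=s(e_{i+1})$; vertices are the paths of length $0$. A vertex is a sink if it emits no edge, and regular if it emits a finite non-zero number of edges. The Leavitt path algebra $L_R(E)$ is the universal (not necessarily unital) associative $R$-algebra generated by pairwise orthogonal idempotents $v$ ($v\in E^0$) and elements $e,e^*$ ($e\in E^1$) subject to $s(e)e=e=er(e)$, $r(e)e^*=e^*=e^*s(e)$, $e^*e=r(e)$, $e^*f=0$ for edges $e\neq f$, and $v=\sum_{s(e)=v}ee^*$ for every regular vertex $v$. It carries the $R$-linear involution $*$ that fixes each $v$ and interchanges $e$ and $e^*$. Let $G_E=\{\alpha\beta^*:\alpha,\beta \text{ paths},\ r(\alpha)=r(\beta)\}$, let $G_E^M=\{x\in G_E: xx^*=x^*x\}$, and let the commutative core $M_R(E)$ be the $R$-subalgebra of $L_R(E)$ generated by $G_E^M$ (a $*$-subalgebra). An element of an $R$-algebra with involution is positive if it is a finite sum of elements $y^*y$. A conditional expectation of an $R$-algebra with involution $\mathcal A$ onto a $*$-subalgebra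 $\mathcal B$ is an $R$-linear map $\mathbb E:\mathcal A\to\mathcal B$ that maps positive elements of $\mathcal A$ to positive elements of $\mathcal B$, is idempotent with image $\mathcal B$, and satisfies $\mathbb E(ba)=b\,\mathbb E(a)$ for all $a\in\mathcal A$, $b\in\mathcal B$. A discrete essentially aperiodic trail $\tau$ is either (i) a finite path (possibly of length zero) whose range is a sink; put $\tau_{\rm (ess)}=\tau$; or (ii) an infinite path $\tau=e_1e_2\cdots$ for which there are $j,k\geq 1$ with $e_{n+k}=e_n$ for all $n\geq j$ and such that, for the (unique) pair $(j,k)$ of this kind with $j+k$ smallest, the closed path $e_j\cdots e_{j+k-1}$ has no exit, that is, every edge with source $s(e_i)$, $j\leq i<j+k$, equals $e_i$; put $\tau_{\rm (ess)}=e_1\cdots e_{j-1}$ (the vertex $s(e_1)$ if $j=1$). Then there is a unique conditional expectation $E_M$ of $L_R(E)$ onto $M_R(E)$ such that $E_M(x)=x$ for $x\in G_E^M$ and $E_M(x)=0$ for $x\in G_E\setminus G_E^M$, and for every $x\in L_R(E)$ and every discrete essentially aperiodic trail $\tau$ in $E$, $$\tau_{\rm (ess)}\tau_{\rm (ess)}^{*}\;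 x\;\tau_{\rm (ess)}\tau_{\rm (ess)}^{*}=E_M(x)\,\tau_{\rm (ess)}\tau_{\rm (ess)}^{*}.$$ -/

import Mathlib

universe u v w

noncomputable section

/-- A directed graph with vertex set `V`, edge set `D`, and source and range maps. -/
structure DirectedGraph (V : Type u) (D : Type v) where
  source : D → V
  range : D → V

namespace DirectedGraph

variable {V : Type u} {D : Type v}

/-- A sink emits no edges. -/
def IsSink (E : DirectedGraph V D) (x : V) : Prop :=
  ∀ e, E.source e ≠ x

/-- `l` is the list of edges of a path which starts at the vertex `x`. -/
def IsChainFrom (E : DirectedGraph V D) : V → List D → Prop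
  | _, [] => True
  | x, e :: l => E.source e = x ∧ IsChainFrom E (E.range e) l

/-- The last vertex reached by following the list of edges `l` from `x`. -/
def endVertex (E : DirectedGraph V D) : V → List D → V
  | x, [] => x
  | _, e :: l => endVertex E (E.range e) l

/-- A finite path: its source and its (possibly empty) list of consecutive edges.
Paths of length zero are the vertices. -/
structure FinPath (E : DirectedGraph V D) where
  source : V
  edges : List D
  chain : E.IsChainFrom source edges

variable {E : DirectedGraph V D}

/-- The range of a finite path. -/
def FinPath.range (μ : E.FinPath) : V := E.endVertex μ.source μ.edges

/-- An exit for a path `e₁ … eₙ`: an edge `f` with `s(f) = s(eᵢ)` and `f ≠ eᵢ` for some `i`. -/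
def FinPath.HasExit (μ : E.FinPath) : Prop :=
  ∃ e ∈ μ.edges, ∃ f, E.source f = E.source e ∧ f ≠ e

/-- Consecutive edges `t 0, t 1, …` form an infinite path. -/
def IsInfinitePath (E : DirectedGraph V D) (t : ℕ → D) : Prop :=
  ∀ n, E.range (t n) = E.source (t (n + 1))

/-- The list `[t j, …, t (j + k - 1)]`. -/
def segmentEdges (t : ℕ → D) : ℕ → ℕ → List D
  | _, 0 => []
  | j, k + 1 => t j :: segmentEdges t (j + 1) k

theorem isChainFrom_segmentEdges {t : ℕ → D} (ht : E.IsInfinitePath t) (j k : ℕ) :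
    E.IsChainFrom (E.source (t j)) (segmentEdges t j k) := by
  induction k generalizing j with
  | zero => trivial
  | succ k ih => exact ⟨rfl, by rw [ht j]; exact ih (j + 1)⟩

/-- The path `t j, …, t (j + k - 1)` inside an infinite path (a vertex if `k = 0`). -/
def segment {t : ℕ → D} (ht : E.IsInfinitePath t) (j k : ℕ) : E.FinPath where
  source := E.source (t j)
  edges := segmentEdges t j k
  chain := isChainFrom_segmentEdges ht j k

/-- From index `j` on (indices start at `0`), the sequence repeats with step `k ≥ 1`. -/
def RepeatsFrom (t : ℕ → D) (j k : ℕ) : Prop :=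
  1 ≤ k ∧ ∀ n, j ≤ n → t (n + k) = t n

/-- The pair `(j, k)` with `j + k` as small as possible. The seed of the infinite path is then
`(t 0 … t (j - 1), t j … t (j + k - 1))`, and its second component is the period. -/
def IsSeedIndex (t : ℕ → D) (j k : ℕ) : Prop :=
  RepeatsFrom t j k ∧ ∀ j' k', RepeatsFrom t j' k' → j + k ≤ j' + k'

/-- A trail is a finite path ending in a sink, or an infinite path. -/
inductive Trail (E : DirectedGraph V D) where
  | finite (μ : E.FinPath) (h : E.IsSink μ.range) : Trail E
  | infinite (t : ℕ → D) (h : E.IsInfinitePath t) : Trail E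

/-- Discrete essentially aperiodic trails: the finite ones, and the periodic infinite ones whose
period has no exit. An infinite path is periodic if it repeats from some index on, that is, if it
has a seed. -/
def Trail.IsDiscrete : E.Trail → Prop
  | .finite _ _ => True
  | .infinite t ht => ∃ j k, IsSeedIndex t j k ∧ ¬ (segment ht j k).HasExit

/-- The essential head of a discrete essentially aperiodic trail: the trail itself if it is finite,
and the first component `t 0 … t (j - 1)` of the seed if it is periodic (the pair of indices
`(j, k)` with `j + k` minimal is unique). -/
def Trail.essHead : (τ : E.Trail) → τ.IsDiscrete → E.FinPath
  | .finite μ _, _ => μ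
  | .infinite _ ht, h => segment ht 0 h.choose

end DirectedGraph

open DirectedGraph

/-- Generators of the Leavitt path algebra: vertices, edges and ghost edges. -/
inductive LeavittGen (V : Type u) (D : Type v) where
  | vertex (x : V)
  | edge (e : D)
  | ghost (e : D)

namespace LeavittGen

variable {V : Type u} {D : Type v}

/-- Interchange edges and ghost edges. -/
def swap : LeavittGen V D → LeavittGen V D
  | vertex x => vertex x
  | edge e => ghost e
  | ghost e => edge e

end LeavittGen

open LeavittGen

/-- The defining relations of the Leavitt path algebra of `E`, for a family `φ` of elements of a
(possibly non-unital) ring indexed by the vertices, edges and ghost edges. -/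
inductive LeavittRel {V : Type u} {D : Type v} (E : DirectedGraph V D) {A : Type*}
    [NonUnitalNonAssocSemiring A] (φ : LeavittGen V D → A) : A → A → Prop
  | vertex_idem (x : V) : LeavittRel E φ (φ (vertex x) * φ (vertex x)) (φ (vertex x))
  | vertex_orth (x y : V) (h : x ≠ y) : LeavittRel E φ (φ (vertex x) * φ (vertex y)) 0
  | source_edge (e : D) : LeavittRel E φ (φ (vertex (E.source e)) * φ (edge e)) (φ (edge e))
  | edge_range (e : D) : LeavittRel E φ (φ (edge e) * φ (vertex (E.range e))) (φ (edge e))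
  | range_ghost (e : D) : LeavittRel E φ (φ (vertex (E.range e)) * φ (ghost e)) (φ (ghost e))
  | ghost_source (e : D) : LeavittRel E φ (φ (ghost e) * φ (vertex (E.source e))) (φ (ghost e))
  | ck1_self (e : D) : LeavittRel E φ (φ (ghost e) * φ (edge e)) (φ (vertex (E.range e)))
  | ck1_ne (e f : D) (h : e ≠ f) : LeavittRel E φ (φ (ghost e) * φ (edge f)) 0
  | ck2 (x : V) (hfin : {e : D | E.source e = x}.Finite) (hne : {e : D | E.source e = x}.Nonempty) :
      LeavittRel E φ (φ (vertex x)) (∑ e ∈ hfin.toFinset, φ (edge e) * φ (ghost e))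

section Construction

variable (R : Type w) [CommRing R] {V : Type u} {D : Type v} (E : DirectedGraph V D)

/-- The free (associative, non-unital) `R`-algebra on the vertices, edges and ghost edges. -/
abbrev LeavittFree (R : Type w) [CommRing R] (V : Type u) (D : Type v) : Type (max u v w) :=
  MonoidAlgebra R (FreeSemigroup (LeavittGen V D))

/-- A generator, as an element of the free algebra. -/
def leavittFreeOf (g : LeavittGen V D) : LeavittFree R V D :=
  MonoidAlgebra.single (FreeSemigroup.of g) 1

/-- The relations, closed under multiplication by scalars. -/
inductive LeavittScalarRel : LeavittFree R V D → LeavittFree R V D → Prop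
  | smul (c : R) (a b : LeavittFree R V D) (h : LeavittRel E (leavittFreeOf R) a b) :
      LeavittScalarRel (c • a) (c • b)

/-- The `R`-algebra congruence generated by the defining relations. -/
def leavittCon : RingCon (LeavittFree R V D) := ringConGen (LeavittScalarRel R E)

theorem leavittCon_smul (c : R) {a b : LeavittFree R V D} (h : leavittCon R E a b) :
    leavittCon R E (c • a) (c • b) := by
  change RingConGen.Rel _ _ _ at h
  change RingConGen.Rel _ _ _
  induction h with
  | of a b h =>
    obtain ⟨d, a, b, h⟩ := h
    rw [smul_smul, smul_smul]
    exact .of _ _ (.smul _ _ _ h)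
  | refl a => exact .refl _
  | symm _ ih => exact .symm ih
  | trans _ _ ih₁ ih₂ => exact .trans ih₁ ih₂
  | add _ _ ih₁ ih₂ => rw [smul_add, smul_add]; exact .add ih₁ ih₂
  | mul h₁ h₂ ih₁ ih₂ =>
    rw [← smul_mul_assoc, ← smul_mul_assoc]; exact .mul ih₁ h₂

/-- The Leavitt path algebra `L_R(E)`: the free `R`-algebra on the vertices, edges and ghost edges
modulo the defining relations. It is non-unital in general. -/
def LeavittPathAlgebra : Type (max u v w) := (leavittCon R E).Quotient

namespace LeavittPathAlgebra

instance : NonUnitalRing (LeavittPathAlgebra R E) :=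
  inferInstanceAs (NonUnitalRing (leavittCon R E).Quotient)

/-- The quotient map. -/
def mk : LeavittFree R V D → LeavittPathAlgebra R E := fun a => (a : (leavittCon R E).Quotient)

theorem mk_surjective : Function.Surjective (mk R E) := Quotient.mk''_surjective

variable {R E} in
theorem mk_eq {a b : LeavittFree R V D} : mk R E a = mk R E b ↔ leavittCon R E a b :=
  (leavittCon R E).eq

theorem mk_add (a b : LeavittFree R V D) : mk R E (a + b) = mk R E a + mk R E b := rfl

theorem mk_mul (a b : LeavittFree R V D) : mk R E (a * b) = mk R E a * mk R E b := rfl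

theorem mk_zero : mk R E 0 = 0 := rfl

instance : SMul R (LeavittPathAlgebra R E) where
  smul c := Quotient.map (c • ·) fun _ _ h => leavittCon_smul R E c h

theorem mk_smul (c : R) (a : LeavittFree R V D) : mk R E (c • a) = c • mk R E a := rfl

instance : Module R (LeavittPathAlgebra R E) where
  one_smul x := by
    obtain ⟨a, rfl⟩ := mk_surjective R E x
    rw [← mk_smul, one_smul]
  mul_smul c d x := by
    obtain ⟨a, rfl⟩ := mk_surjective R E x
    rw [← mk_smul, mul_smul]; rfl
  smul_zero c := by rw [← mk_zero, ← mk_smul, smul_zero]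
  smul_add c x y := by
    obtain ⟨a, rfl⟩ := mk_surjective R E x
    obtain ⟨b, rfl⟩ := mk_surjective R E y
    rw [← mk_add, ← mk_smul, smul_add]; rfl
  add_smul c d x := by
    obtain ⟨a, rfl⟩ := mk_surjective R E x
    rw [← mk_smul, add_smul]; rfl
  zero_smul x := by
    obtain ⟨a, rfl⟩ := mk_surjective R E x
    rw [← mk_smul, zero_smul]; rfl

instance : IsScalarTower R (LeavittPathAlgebra R E) (LeavittPathAlgebra R E) where
  smul_assoc c x y := by
    obtain ⟨a, rfl⟩ := mk_surjective R E x
    obtain ⟨b, rfl⟩ := mk_surjective R E y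
    change mk R E ((c • a) * b) = mk R E (c • (a * b))
    rw [smul_mul_assoc]

instance : SMulCommClass R (LeavittPathAlgebra R E) (LeavittPathAlgebra R E) where
  smul_comm c x y := by
    obtain ⟨a, rfl⟩ := mk_surjective R E x
    obtain ⟨b, rfl⟩ := mk_surjective R E y
    change mk R E (c • (a * b)) = mk R E (a * (c • b))
    rw [mul_smul_comm]

/-- The quotient map as a homomorphism of `R`-algebras. -/
def mkHom : LeavittFree R V D →ₙₐ[R] LeavittPathAlgebra R E where
  toFun := mk R E
  map_smul' _ _ := rfl
  map_zero' := rfl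
  map_add' _ _ := rfl
  map_mul' _ _ := rfl

/-- A generator, as an element of the Leavitt path algebra. -/
def of (g : LeavittGen V D) : LeavittPathAlgebra R E := mk R E (leavittFreeOf R g)

section Universal

variable {R E}
variable {A : Type*} [NonUnitalRing A] [Module R A] [IsScalarTower R A A] [SMulCommClass R A A]

theorem map_leavittRel {A B : Type*} [NonUnitalRing A] [NonUnitalRing B]
    (F : A →ₙ+* B) {φ : LeavittGen V D → A} {a b : A} (h : LeavittRel E φ a b) :
    LeavittRel E (fun g => F (φ g)) (F a) (F b) := by
  cases h <;> simp only [map_mul, map_zero, map_sum] <;> constructor <;> assumption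

theorem of_rel {a b : LeavittPathAlgebra R E} (h : LeavittRel E (of R E) a b) : a = b := by
  have key : ∀ a b : LeavittFree R V D, LeavittRel E (leavittFreeOf R) a b →
      mkHom R E a = mkHom R E b := fun a b h => mk_eq.2 <| by
    have := RingConGen.Rel.of _ _ (LeavittScalarRel.smul (E := E) 1 a b h)
    rwa [one_smul, one_smul] at this
  have hof : ∀ g, mkHom R E (leavittFreeOf R g) = of R E g := fun _ => rfl
  cases h with
  | vertex_idem x => simpa only [map_mul, hof] using key _ _ (.vertex_idem x)
  | vertex_orth x y h => simpa only [map_mul, hof, map_zero] using key _ _ (.vertex_orth x y h)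
  | source_edge e => simpa only [map_mul, hof] using key _ _ (.source_edge e)
  | edge_range e => simpa only [map_mul, hof] using key _ _ (.edge_range e)
  | range_ghost e => simpa only [map_mul, hof] using key _ _ (.range_ghost e)
  | ghost_source e => simpa only [map_mul, hof] using key _ _ (.ghost_source e)
  | ck1_self e => simpa only [map_mul, hof] using key _ _ (.ck1_self e)
  | ck1_ne e f h => simpa only [map_mul, hof, map_zero] using key _ _ (.ck1_ne e f h)
  | ck2 x hfin hne => simpa only [map_mul, hof, map_sum] using key _ _ (.ck2 x hfin hne)

/-- The homomorphism on the free algebra given by the images of the generators. -/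
def freeLift (φ : LeavittGen V D → A) : LeavittFree R V D →ₙₐ[R] A :=
  MonoidAlgebra.liftMagma R (FreeSemigroup.lift φ)

theorem freeLift_of (φ : LeavittGen V D → A) (g : LeavittGen V D) :
    freeLift (R := R) φ (leavittFreeOf R g) = φ g := by
  simp [freeLift, leavittFreeOf, MonoidAlgebra.liftMagma]

theorem freeLift_rel (φ : LeavittGen V D → A) (hφ : ∀ a b, LeavittRel E φ a b → a = b)
    {a b : LeavittFree R V D} (h : leavittCon R E a b) :
    freeLift (R := R) φ a = freeLift φ b := by
  change RingConGen.Rel _ _ _ at h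
  induction h with
  | of a b h =>
    obtain ⟨c, a, b, h⟩ := h
    rw [map_smul, map_smul]
    congr 1
    apply hφ
    have := map_leavittRel (freeLift (R := R) φ : LeavittFree R V D →ₙ+* A) h
    have hof : (fun g => (freeLift (R := R) φ : LeavittFree R V D →ₙ+* A) (leavittFreeOf R g)) = φ :=
      funext fun g => freeLift_of φ g
    rwa [hof] at this
  | refl a => rfl
  | symm _ ih => exact ih.symm
  | trans _ _ ih₁ ih₂ => exact ih₁.trans ih₂
  | add _ _ ih₁ ih₂ => rw [map_add, map_add, ih₁, ih₂]
  | mul h₁ h₂ ih₁ ih₂ => rw [map_mul, map_mul, ih₁, ih₂]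

/-- The universal property: every family in an `R`-algebra which satisfies the defining relations
extends to a homomorphism. -/
def lift (φ : LeavittGen V D → A) (hφ : ∀ a b, LeavittRel E φ a b → a = b) :
    LeavittPathAlgebra R E →ₙₐ[R] A where
  toFun := Quotient.lift (freeLift (R := R) φ) fun _ _ h => freeLift_rel φ hφ h
  map_smul' c x := by
    obtain ⟨a, rfl⟩ := mk_surjective R E x
    exact map_smul (freeLift (R := R) φ) c a
  map_zero' := map_zero (freeLift (R := R) φ)
  map_add' x y := by
    obtain ⟨a, rfl⟩ := mk_surjective R E x
    obtain ⟨b, rfl⟩ := mk_surjective R E y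
    exact map_add (freeLift (R := R) φ) a b
  map_mul' x y := by
    obtain ⟨a, rfl⟩ := mk_surjective R E x
    obtain ⟨b, rfl⟩ := mk_surjective R E y
    exact map_mul (freeLift (R := R) φ) a b

theorem lift_of (φ : LeavittGen V D → A) (hφ : ∀ a b, LeavittRel E φ a b → a = b)
    (g : LeavittGen V D) : lift (R := R) φ hφ (of R E g) = φ g :=
  freeLift_of φ g

theorem hom_ext {F G : LeavittPathAlgebra R E →ₙₐ[R] A}
    (h : ∀ g, F (of R E g) = G (of R E g)) : F = G := by
  have key : F.comp (mkHom R E) = G.comp (mkHom R E) := by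
    apply (MonoidAlgebra.liftMagma R).symm.injective
    apply FreeSemigroup.hom_ext
    funext g
    exact h g
  ext x
  obtain ⟨a, rfl⟩ := mk_surjective R E x
  exact DFunLike.congr_fun key a

end Universal

/-- The involution as a homomorphism to the opposite algebra: it fixes the vertices and
interchanges each edge with its ghost edge. -/
def starHom : LeavittPathAlgebra R E →ₙₐ[R] (LeavittPathAlgebra R E)ᵐᵒᵖ :=
  lift (fun g => MulOpposite.op (of R E g.swap)) fun a b h => by
    cases h with
    | vertex_idem x => exact congrArg MulOpposite.op (of_rel (.vertex_idem x))
    | vertex_orth x y h => exact congrArg MulOpposite.op (of_rel (.vertex_orth y x h.symm))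
    | source_edge e => exact congrArg MulOpposite.op (of_rel (.ghost_source e))
    | edge_range e => exact congrArg MulOpposite.op (of_rel (.range_ghost e))
    | range_ghost e => exact congrArg MulOpposite.op (of_rel (.edge_range e))
    | ghost_source e => exact congrArg MulOpposite.op (of_rel (.source_edge e))
    | ck1_self e => exact congrArg MulOpposite.op (of_rel (.ck1_self e))
    | ck1_ne e f h => exact congrArg MulOpposite.op (of_rel (.ck1_ne f e h.symm))
    | ck2 x hfin hne =>
      refine (congrArg MulOpposite.op (of_rel (.ck2 x hfin hne))).trans ?_
      exact map_sum (MulOpposite.opAddEquiv (α := LeavittPathAlgebra R E)) _ _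

instance : Star (LeavittPathAlgebra R E) where
  star x := (starHom R E x).unop

theorem star_def (x : LeavittPathAlgebra R E) : star x = (starHom R E x).unop := rfl

theorem star_of (g : LeavittGen V D) : star (of R E g) = of R E g.swap := by
  rw [star_def, starHom, lift_of]; rfl

theorem star_smul' (c : R) (x : LeavittPathAlgebra R E) : star (c • x) = c • star x := by
  rw [star_def, map_smul]; rfl

/-- The involution composed with itself, as a homomorphism. -/
def starStarHom : LeavittPathAlgebra R E →ₙₐ[R] LeavittPathAlgebra R E where
  toFun x := star (star x)
  map_smul' c x := by simp only [star_smul', MonoidHom.id_apply]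
  map_zero' := by simp [star_def]
  map_add' x y := by simp [star_def]
  map_mul' x y := by simp [star_def]

instance : StarRing (LeavittPathAlgebra R E) where
  star_involutive x := by
    have h : starStarHom R E = NonUnitalAlgHom.id R (LeavittPathAlgebra R E) := hom_ext fun g => by
      change star (star (of R E g)) = of R E g
      rw [star_of, star_of]
      cases g <;> rfl
    exact DFunLike.congr_fun h x
  star_mul x y := by simp [star_def]
  star_add x y := by simp [star_def]

/-- The element of the algebra given by the list of edges `e₁, …, eₙ` from `x`: it is
`e₁ ⋯ eₙ r(eₙ) = e₁ ⋯ eₙ`, and `x` for the empty list. -/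
def ofEdges : V → List D → LeavittPathAlgebra R E
  | x, [] => of R E (vertex x)
  | _, e :: l => of R E (edge e) * ofEdges (E.range e) l

variable {E}

/-- A finite path as an element of the Leavitt path algebra. -/
def ofPath (μ : E.FinPath) : LeavittPathAlgebra R E := ofEdges R E μ.source μ.edges

variable (E)

/-- The standard generators `α β*`, with `r(α) = r(β)`. -/
def stdGenerators : Set (LeavittPathAlgebra R E) :=
  {x | ∃ α β : E.FinPath, α.range = β.range ∧ x = ofPath R α * star (ofPath R β)}

/-- The standard generators `x` which are normal, `x x* = x* x`. -/
def normalGenerators : Set (LeavittPathAlgebra R E) :=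
  {x | x ∈ stdGenerators R E ∧ x * star x = star x * x}

theorem star_mem_normalGenerators {x : LeavittPathAlgebra R E} (hx : x ∈ normalGenerators R E) :
    star x ∈ normalGenerators R E := by
  obtain ⟨⟨α, β, h, rfl⟩, hn⟩ := hx
  refine ⟨⟨β, α, h.symm, ?_⟩, ?_⟩
  · rw [star_mul, star_star]
  · rw [star_star]; exact hn.symm

/-- The commutative core `M_R(E)`: the `R`-subalgebra generated by the normal standard generators.
It is stable under the involution. -/
def core : NonUnitalStarSubalgebra R (LeavittPathAlgebra R E) where
  toNonUnitalSubalgebra := NonUnitalAlgebra.adjoin R (normalGenerators R E)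
  star_mem' := by
    intro x hx
    change x ∈ NonUnitalAlgebra.adjoin R (normalGenerators R E) at hx
    change star x ∈ NonUnitalAlgebra.adjoin R (normalGenerators R E)
    induction hx using NonUnitalAlgebra.adjoin_induction with
    | mem x hx => exact NonUnitalAlgebra.subset_adjoin R (star_mem_normalGenerators R E hx)
    | add x y _ _ hx hy => rw [star_add]; exact add_mem hx hy
    | zero => rw [star_zero]; exact zero_mem _
    | mul x y _ _ hx hy => rw [star_mul]; exact mul_mem hy hx
    | smul c x _ hx => rw [star_smul']; exact SMulMemClass.smul_mem c hx

end LeavittPathAlgebra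

end Construction

/-- Positive elements of a ring with involution: finite sums of elements `x* x`. -/
def IsAlgPositive {A : Type*} [NonUnitalRing A] [StarRing A] (a : A) : Prop :=
  a ∈ AddSubmonoid.closure {y : A | ∃ x : A, y = star x * x}

/-- Algebraic conditional expectations of `A` onto a subalgebra `B` which is stable under the
involution: positive linear maps, idempotent with image `B`, and `B`-linear. -/
structure IsCondExpectation {R : Type*} {A : Type*} [CommRing R] [NonUnitalRing A] [StarRing A]
    [Module R A] (B : NonUnitalStarSubalgebra R A) (F : A →ₗ[R] B) : Prop where
  positive : ∀ a : A, IsAlgPositive a → IsAlgPositive (F a)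
  idempotent : ∀ a : A, F (F a : A) = F a
  surjective : Function.Surjective F
  left_linear : ∀ (b : B) (a : A), F ((b : A) * a) = b * F a

namespace LeavittPathAlgebra

/-- The conditional expectation `E_M` of `L_R(E)` onto its commutative core: it fixes the normal
standard generators and annihilates the other standard generators. -/
structure IsCoreExpectation {R : Type w} [CommRing R] {V : Type u} {D : Type v}
    {E : DirectedGraph V D} (F : LeavittPathAlgebra R E →ₗ[R] core R E) : Prop where
  isCondExpectation : IsCondExpectation (core R E) F
  map_normal : ∀ x ∈ normalGenerators R E, (F x : LeavittPathAlgebra R E) = x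
  map_not_normal : ∀ x ∈ stdGenerators R E, x ∉ normalGenerators R E →
    (F x : LeavittPathAlgebra R E) = 0

end LeavittPathAlgebra

end

section

open DirectedGraph LeavittGen

/-! ### Concatenation of edge lists. -/

namespace DirectedGraph

variable {V : Type u} {D : Type v} {E : DirectedGraph V D}

/-! The normality of `α β*`, with `r(α) = r(β)`, is a condition on paths. Since `x x* = α α*` and
`x* x = β β*`, it says `α α* = β β*`, and over a nontrivial ring this holds exactly when `α` and `β`
are `Aligned`: they are equal, or one extends the other and no exit can be reached from their common
range. If there are no exits, (CK2) gives `c c* = s(c)`, so lengthening a path does not change its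
projection. Conversely, if `β = α c` and `α α* = β β*`, then `c` is a closed path with `c c* =
s(c)`, which leaves no room for an exit (`Aligned.of_mul_star_eq`).

Alignment is an equivalence relation on paths, and a common extension neither creates nor destroys
it (`aligned_append`). It is therefore compatible with (CK2), and "keep the aligned `α β*`, kill the
others" is a well-defined linear map (`exists_linearMap`, `coreProj`). Multiplying `γ δ*` by an
aligned generator gives zero or a generator that is aligned exactly when `γ δ*` is, so the map is
linear over the core. Uniqueness holds because the `α β*` span the algebra.

For positivity, every `y` is written as `∑ t z_t` with `z_t` in the core and generators `t` such
that `E_M(t* t') = 0` for `t ≠ t'`. Then `E_M(y* y) = ∑ z_t* (t* t) z_t`, and the `t* t` are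
projections in the core.

The range of `τ_(ess)` reaches no exit. Hence for `p = τ_(ess) τ_(ess)*` the corner `p x p` lies in
the core, which commutes with `p`, and `p x p = E_M(p x p) = p E_M(x) p = E_M(x) p`. -/

theorem endVertex_append (x : V) (a b : List D) :
    E.endVertex x (a ++ b) = E.endVertex (E.endVertex x a) b := by
  induction a generalizing x with
  | nil => rfl
  | cons e a ih => exact ih _

theorem isChainFrom_append (x : V) (a b : List D) :
    E.IsChainFrom x (a ++ b) ↔ E.IsChainFrom x a ∧ E.IsChainFrom (E.endVertex x a) b := by
  induction a generalizing x with
  | nil => simp [IsChainFrom, endVertex]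
  | cons e a ih => simp only [List.cons_append, IsChainFrom, endVertex, ih, and_assoc]

theorem endVertex_concat (x : V) (a : List D) (e : D) :
    E.endVertex x (a ++ [e]) = E.range e := by
  rw [endVertex_append]; rfl

theorem isChainFrom_concat (x : V) (a : List D) (e : D) :
    E.IsChainFrom x (a ++ [e]) ↔ E.IsChainFrom x a ∧ E.source e = E.endVertex x a := by
  rw [isChainFrom_append]; simp [IsChainFrom]

end DirectedGraph

/-! ### Linear maps on the algebra prescribed on the elements `α β*`. -/

namespace LeavittPathAlgebra

section Functionals

variable (R : Type w) [CommRing R] {V : Type u} {D : Type v} (E : DirectedGraph V D)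
variable (N : Type*) [AddCommGroup N] [Module R N]

/-- Values of a functional at a formal unit, and at the elements `α β*`, where `α` is given by its
source and edges, and `β` likewise. -/
abbrev Values (V : Type u) (D : Type v) (N : Type*) :=
  N × (V × List D → V → List D → N)

open Classical in
/-- The values of `z ↦ g (z v)` for a vertex `v`. -/
noncomputable def vertexShift (x : V) : Values V D N →ₗ[R] Values V D N where
  toFun g := (g.2 (x, []) x [], fun p y b => if y = x then g.2 p y b else 0)
  map_add' g h := by
    refine Prod.ext rfl ?_
    funext p y b
    by_cases hy : y = x <;> simp [hy]
  map_smul' c g := by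
    refine Prod.ext rfl ?_
    funext p y b
    by_cases hy : y = x <;> simp [hy]

open Classical in
/-- The values of `z ↦ g (z e)` for an edge `e`. -/
noncomputable def edgeShift (e : D) : Values V D N →ₗ[R] Values V D N where
  toFun g := (g.2 (E.source e, [e]) (E.range e) [], fun p y b =>
    match b with
    | [] => if y = E.source e then g.2 (p.1, p.2 ++ [e]) (E.range e) [] else 0
    | e' :: b' => if e' = e ∧ y = E.source e then g.2 p (E.range e) b' else 0)
  map_add' g h := by
    refine Prod.ext rfl ?_
    funext p y b
    cases b <;> simp only [Prod.snd_add, Pi.add_apply] <;> split_ifs <;> simp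
  map_smul' c g := by
    refine Prod.ext rfl ?_
    funext p y b
    cases b <;> simp only [Prod.smul_snd, Pi.smul_apply] <;> split_ifs <;> simp

open Classical in
/-- The values of `z ↦ g (z e*)` for an edge `e`. -/
noncomputable def ghostShift (e : D) : Values V D N →ₗ[R] Values V D N where
  toFun g := (g.2 (E.range e, []) (E.source e) [e],
    fun p y b => if y = E.range e then g.2 p (E.source e) (e :: b) else 0)
  map_add' g h := by
    refine Prod.ext rfl ?_
    funext p y b
    by_cases hy : y = E.range e <;> simp [hy]
  map_smul' c g := by
    refine Prod.ext rfl ?_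
    funext p y b
    by_cases hy : y = E.range e <;> simp [hy]

/-- Values which vanish outside the paths and are compatible with
`α β* = ∑ e, (α e) (β e)*` at the regular vertices. -/
def compatibleValues : Submodule R (Values V D N) where
  carrier := {g | (∀ p y b, ¬ E.IsChainFrom y b → g.2 p y b = 0) ∧
    ∀ (p : V × List D) (y : V) (b : List D), E.IsChainFrom y b →
      ∀ hfin : {e : D | E.source e = E.endVertex y b}.Finite,
        {e : D | E.source e = E.endVertex y b}.Nonempty →
        g.2 p y b = ∑ e ∈ hfin.toFinset, g.2 (p.1, p.2 ++ [e]) y (b ++ [e])}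
  zero_mem' := by simp
  add_mem' := by
    rintro g h ⟨hg, hg'⟩ ⟨hh, hh'⟩
    refine ⟨fun p y b hb => by simp [hg p y b hb, hh p y b hb], fun p y b hb hfin hne => ?_⟩
    simp only [Prod.snd_add, Pi.add_apply, Finset.sum_add_distrib]
    rw [hg' p y b hb hfin hne, hh' p y b hb hfin hne]
  smul_mem' := by
    rintro c g ⟨hg, hg'⟩
    refine ⟨fun p y b hb => by simp [hg p y b hb], fun p y b hb hfin hne => ?_⟩
    simp only [Prod.smul_snd, Pi.smul_apply, ← Finset.smul_sum]
    rw [hg' p y b hb hfin hne]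

theorem vertexShift_mem (x : V) (g : Values V D N) (hg : g ∈ compatibleValues R E N) :
    vertexShift R N x g ∈ compatibleValues R E N := by
  obtain ⟨hg, hg'⟩ := hg
  refine ⟨fun p y b hb => by simp [vertexShift, hg p y b hb], fun p y b hb hfin hne => ?_⟩
  by_cases hy : y = x
  · simpa [vertexShift, hy] using hg' p x b (hy ▸ hb) (hy ▸ hfin) (hy ▸ hne)
  · simp [vertexShift, hy]

theorem edgeShift_mem (e : D) (g : Values V D N) (hg : g ∈ compatibleValues R E N) :
    edgeShift R E N e g ∈ compatibleValues R E N := by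
  obtain ⟨hg, hg'⟩ := hg
  refine ⟨fun p y b hb => ?_, fun p y b hb hfin hne => ?_⟩
  · cases b with
    | nil => exact absurd trivial hb
    | cons e' b' =>
      simp only [edgeShift, LinearMap.coe_mk, AddHom.coe_mk]
      split_ifs with h
      · obtain ⟨rfl, rfl⟩ := h
        exact hg _ _ _ fun h => hb ⟨rfl, h⟩
      · rfl
  · cases b with
    | nil =>
      simp only [edgeShift, LinearMap.coe_mk, AddHom.coe_mk, List.nil_append]
      by_cases hy : y = E.source e
      · subst hy
        rw [if_pos rfl, Finset.sum_eq_single e]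
        · simp
        · intro e' _ he'
          simp [he']
        · intro h
          exact absurd (hfin.mem_toFinset.2 rfl) h
      · simp [hy]
    | cons e' b' =>
      simp only [edgeShift, LinearMap.coe_mk, AddHom.coe_mk, List.cons_append]
      split_ifs with h
      · obtain ⟨rfl, rfl⟩ := h
        exact hg' p _ b' hb.2 hfin hne
      · simp

theorem ghostShift_mem (e : D) (g : Values V D N) (hg : g ∈ compatibleValues R E N) :
    ghostShift R E N e g ∈ compatibleValues R E N := by
  obtain ⟨hg, hg'⟩ := hg
  refine ⟨fun p y b hb => ?_, fun p y b hb hfin hne => ?_⟩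
  · simp only [ghostShift, LinearMap.coe_mk, AddHom.coe_mk]
    split_ifs with h
    · subst h
      exact hg _ _ _ fun h => hb h.2
    · rfl
  · simp only [ghostShift, LinearMap.coe_mk, AddHom.coe_mk]
    split_ifs with h
    · subst h
      exact hg' p _ (e :: b) ⟨rfl, hb⟩ hfin hne
    · simp

/-- Right multiplication by the generators, acting on values. -/
noncomputable def shift : LeavittGen V D → Module.End R (compatibleValues R E N)
  | .vertex x => (vertexShift R N x).restrict (vertexShift_mem R E N x)
  | .edge e => (edgeShift R E N e).restrict (edgeShift_mem R E N e)
  | .ghost e => (ghostShift R E N e).restrict (ghostShift_mem R E N e)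

/-- A functional `g` is acted on by `(w g)(z) = g(z w)`, which is a left action, so the relations
keep their order. The formal unit stands in for the missing identity: it lets `g(w)` be recovered
from `w g`. Only (CK2) uses the compatibility of the values. -/
theorem shift_rel (a b : Module.End R (compatibleValues R E N))
    (h : LeavittRel E (shift R E N) a b) : a = b := by
  refine LinearMap.ext fun ⟨g, hg⟩ => Subtype.ext (Prod.ext ?_ (funext fun p => funext fun y =>
    funext fun l => ?_))
  · cases h with
    | ck2 x hfin hne =>
      have := hg.2 (x, []) x [] trivial hfin hne
      simp only [LinearMap.sum_apply, Submodule.coe_sum, Prod.fst_sum]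
      simp only [shift, vertexShift, edgeShift, ghostShift, Module.End.mul_apply,
        LinearMap.restrict_apply, LinearMap.coe_mk, AddHom.coe_mk, if_true]
      rw [this]
      refine Finset.sum_congr rfl fun e he => ?_
      have he : E.source e = x := by simpa using he
      subst he
      rfl
    | _ => simp_all [shift, vertexShift, edgeShift, ghostShift, LinearMap.restrict_apply, eq_comm]
  · cases h with
    | ck2 x hfin hne =>
      simp only [LinearMap.sum_apply, Submodule.coe_sum, Prod.snd_sum, Finset.sum_apply]
      simp only [shift, vertexShift, edgeShift, ghostShift, Module.End.mul_apply,
        LinearMap.restrict_apply, LinearMap.coe_mk, AddHom.coe_mk, if_true]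
      by_cases hy : y = x
      · subst hy
        rw [if_pos rfl]
        -- If `β` is a vertex, this is the compatibility equation itself. If `β` starts with an
        -- edge, (CK1) leaves only the summand of that edge; when the edge does not start at `y`,
        -- both sides vanish because `β` is not a path.
        cases l with
        | nil =>
          rw [hg.2 p y [] trivial hfin hne]
          refine Finset.sum_congr rfl fun e he => ?_
          have he : E.source e = y := by simpa using he
          subst he
          simp
        | cons e' l =>
          simp only
          by_cases he : E.source e' = y
          · subst he
            rw [Finset.sum_eq_single e']
            · simp
            · intro e _ he
              simp [he.symm]
            · intro h
              exact absurd (hfin.mem_toFinset.2 rfl) h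
          · rw [hg.1 p y (e' :: l) fun h => he h.1, Finset.sum_eq_zero]
            intro e _
            rw [if_neg]
            rintro ⟨rfl, h⟩
            exact he h.symm
      · rw [if_neg hy, Finset.sum_eq_zero]
        intro e he
        have he : E.source e = x := by simpa using he
        subst he
        cases l <;> simp [hy]
    | _ =>
      cases l <;>
      simp only [shift, vertexShift, edgeShift, ghostShift, Module.End.mul_apply,
        LinearMap.restrict_apply, LinearMap.coe_mk, AddHom.coe_mk, LinearMap.zero_apply,
        Submodule.coe_zero, Prod.snd_zero, Pi.zero_apply] <;> grind

/-- The action of the Leavitt path algebra on compatible values. -/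
noncomputable def shiftHom : LeavittPathAlgebra R E →ₙₐ[R] Module.End R (compatibleValues R E N) :=
  lift (shift R E N) (shift_rel R E N)

theorem shiftHom_of (g : LeavittGen V D) : shiftHom R E N (of R E g) = shift R E N g :=
  lift_of _ _ g

theorem star_ofEdges_nil (x : V) : star (ofEdges R E x []) = of R E (vertex x) :=
  star_of R E _

theorem star_ofEdges_cons (x : V) (e : D) (a : List D) :
    star (ofEdges R E x (e :: a)) = star (ofEdges R E (E.range e) a) * of R E (ghost e) := by
  rw [ofEdges, star_mul, star_of]; rfl

theorem shiftHom_star_ofEdges (y : V) (b : List D) (hb : E.IsChainFrom y b)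
    (g : compatibleValues R E N) (p : V × List D) :
    (shiftHom R E N (star (ofEdges R E y b)) g).1.2 p (E.endVertex y b) [] = g.1.2 p y b := by
  induction b generalizing y g with
  | nil =>
    rw [star_ofEdges_nil, shiftHom_of]
    simp [shift, vertexShift, endVertex, LinearMap.restrict_apply]
  | cons e b ih =>
    obtain ⟨rfl, hb⟩ := hb
    rw [star_ofEdges_cons, map_mul, Module.End.mul_apply, endVertex, ih _ hb, shiftHom_of]
    simp [shift, ghostShift, LinearMap.restrict_apply]

theorem shiftHom_ofEdges_snd (x : V) (a : List D) (ha : E.IsChainFrom x a)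
    (g : compatibleValues R E N) (p : V × List D) :
    (shiftHom R E N (ofEdges R E x a) g).1.2 p x [] =
      g.1.2 (p.1, p.2 ++ a) (E.endVertex x a) [] := by
  induction a generalizing x p with
  | nil =>
    rw [ofEdges, shiftHom_of]
    simp [shift, vertexShift, endVertex, LinearMap.restrict_apply]
  | cons e a ih =>
    obtain ⟨rfl, ha⟩ := ha
    have := ih _ ha (p.1, p.2 ++ [e])
    rw [ofEdges, map_mul, Module.End.mul_apply, shiftHom_of]
    simp [shift, edgeShift, endVertex, LinearMap.restrict_apply, this]

theorem shiftHom_ofEdges_fst (x : V) (a : List D) (ha : E.IsChainFrom x a)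
    (g : compatibleValues R E N) :
    (shiftHom R E N (ofEdges R E x a) g).1.1 = g.1.2 (x, a) (E.endVertex x a) [] := by
  cases a with
  | nil =>
    rw [ofEdges, shiftHom_of]
    simp [shift, vertexShift, endVertex, LinearMap.restrict_apply]
  | cons e a =>
    obtain ⟨rfl, ha⟩ := ha
    have := shiftHom_ofEdges_snd R E N _ a ha g (E.source e, [e])
    rw [ofEdges, map_mul, Module.End.mul_apply, shiftHom_of]
    simp [shift, edgeShift, endVertex, LinearMap.restrict_apply, this]

variable {R E N}

/-- A function of pairs of paths with a common range extends to a linear map on the Leavitt path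
algebra if it is compatible with `α β* = ∑ e, (α e) (β e)*`. -/
theorem exists_linearMap (φ : V → List D → V → List D → N)
    (h : ∀ x a y b, E.IsChainFrom x a → E.IsChainFrom y b → E.endVertex x a = E.endVertex y b →
      ∀ hfin : {e : D | E.source e = E.endVertex y b}.Finite,
        {e : D | E.source e = E.endVertex y b}.Nonempty →
        φ x a y b = ∑ e ∈ hfin.toFinset, φ x (a ++ [e]) y (b ++ [e])) :
    ∃ T : LeavittPathAlgebra R E →ₗ[R] N, ∀ x a y b, E.IsChainFrom x a → E.IsChainFrom y b →
      E.endVertex x a = E.endVertex y b →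
      T (ofEdges R E x a * star (ofEdges R E y b)) = φ x a y b := by
  classical
  let f : V × List D → V → List D → N := fun p y b =>
    if E.IsChainFrom p.1 p.2 ∧ E.IsChainFrom y b ∧ E.endVertex p.1 p.2 = E.endVertex y b
    then φ p.1 p.2 y b else 0
  have hf : ((0, f) : Values V D N) ∈ compatibleValues R E N := by
    refine ⟨fun p y b hb => if_neg fun h => hb h.2.1, fun p y b hb hfin hne => ?_⟩
    simp only [f]
    split_ifs with hp
    · rw [h _ _ _ _ hp.1 hp.2.1 hp.2.2 hfin hne]
      refine Finset.sum_congr rfl fun e he => ?_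
      have he : E.source e = E.endVertex y b := by simpa using he
      rw [if_pos]
      simp [isChainFrom_concat, endVertex_concat, hp, he]
    · rw [Finset.sum_eq_zero]
      intro e he
      have he : E.source e = E.endVertex y b := by simpa using he
      rw [if_neg]
      simp only [isChainFrom_concat, endVertex_concat]
      rintro ⟨⟨h1, h2⟩, _⟩
      exact hp ⟨h1, hb, h2.symm.trans he⟩
  -- The map is evaluation of `z g` at the formal unit. The value `0` of `g` itself there is a
  -- dummy, since no shift reads it.
  refine ⟨{ toFun := fun z => (shiftHom R E N z ⟨(0, f), hf⟩).1.1
            map_add' := fun z z' => by simp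
            map_smul' := fun c z => by simp }, fun x a y b ha hb hab => ?_⟩
  simp only [LinearMap.coe_mk, AddHom.coe_mk, map_mul, Module.End.mul_apply]
  rw [shiftHom_ofEdges_fst R E N x a ha, hab, shiftHom_star_ofEdges R E N y b hb]
  exact if_pos ⟨ha, hb, hab⟩

end Functionals

end LeavittPathAlgebra

/-! ### Aligned pairs of paths. -/

namespace DirectedGraph

variable {V : Type u} {D : Type v} {E : DirectedGraph V D}

/-- No vertex which can be reached from `x` emits more than one edge. -/
def NoExits (E : DirectedGraph V D) (x : V) : Prop :=
  ∀ c, E.IsChainFrom x c → ∀ e f, E.source e = E.endVertex x c → E.source f = E.endVertex x c →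
    e = f

theorem NoExits.endVertex {x : V} (h : E.NoExits x) {c : List D} (hc : E.IsChainFrom x c) :
    E.NoExits (E.endVertex x c) := fun d hd e f he hf =>
  h (c ++ d) ((isChainFrom_append _ _ _).2 ⟨hc, hd⟩) e f
    (by rw [he, endVertex_append]) (by rw [hf, endVertex_append])

/-- From a vertex that reaches no exit, each next edge is forced. -/
theorem NoExits.prefix_or_prefix {x : V} (h : E.NoExits x) {c d : List D}
    (hc : E.IsChainFrom x c) (hd : E.IsChainFrom x d) : c <+: d ∨ d <+: c := by
  induction c generalizing x d with
  | nil => exact .inl List.nil_prefix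
  | cons e c ih =>
    cases d with
    | nil => exact .inr List.nil_prefix
    | cons f d =>
      obtain rfl : e = f := h [] trivial e f hc.1 hd.1
      have h' : E.NoExits (E.range e) := h.endVertex (c := [e]) ⟨hc.1, trivial⟩
      simpa [List.cons_prefix_cons] using ih h' hc.2 hd.2

/-- Two paths `α` and `β` with the same range are aligned if `α = β`, or if one of them extends the
other and no exits can be reached from their range. -/
def Aligned (E : DirectedGraph V D) (x : V) (a : List D) (y : V) (b : List D) : Prop :=
  x = y ∧ E.endVertex x a = E.endVertex y b ∧
    (a = b ∨ E.NoExits (E.endVertex x a) ∧ (a <+: b ∨ b <+: a))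

theorem Aligned.refl (x : V) (a : List D) : E.Aligned x a x a := ⟨rfl, rfl, .inl rfl⟩

theorem Aligned.symm {x y : V} {a b : List D} (h : E.Aligned x a y b) : E.Aligned y b x a := by
  obtain ⟨rfl, h, h'⟩ := h
  refine ⟨rfl, h.symm, ?_⟩
  rcases h' with h' | ⟨h', h''⟩
  · exact .inl h'.symm
  · exact .inr ⟨h ▸ h', h''.symm⟩

theorem Aligned.trans {x y z : V} {a b c : List D} (ha : E.IsChainFrom x a)
    (hc : E.IsChainFrom z c) (h : E.Aligned x a y b) (h' : E.Aligned y b z c) :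
    E.Aligned x a z c := by
  obtain ⟨rfl, h1, h2⟩ := h
  obtain ⟨rfl, h1', h2'⟩ := h'
  refine ⟨rfl, h1.trans h1', ?_⟩
  rcases h2 with rfl | ⟨hn, h2⟩
  · exact h2'
  rcases h2' with rfl | ⟨hn', h2'⟩
  · exact .inr ⟨hn, h2⟩
  refine .inr ⟨hn, ?_⟩
  rcases h2 with h2 | h2 <;> rcases h2' with h2' | h2'
  · exact .inl (h2.trans h2')
  · exact List.prefix_or_prefix_of_prefix h2 h2'
  -- Here `a` and `c` both extend `b`. Their tails start at the range of `b`, where the next edge is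
  -- always forced, so they are comparable.
  · obtain ⟨s, rfl⟩ := h2
    obtain ⟨t, rfl⟩ := h2'
    rw [List.prefix_append_right_inj, List.prefix_append_right_inj]
    rw [isChainFrom_append] at ha hc
    rw [h1] at hn
    exact hn.prefix_or_prefix ha.2 hc.2
  · exact .inr (h2'.trans h2)

theorem Aligned.concat {x y : V} {a b : List D} (ha : E.IsChainFrom x a) (hb : E.IsChainFrom y b)
    (h : E.Aligned x a y b) {e : D} (he : E.source e = E.endVertex x a) :
    E.Aligned x (a ++ [e]) y (b ++ [e]) := by
  obtain ⟨rfl, h, h'⟩ := h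
  refine ⟨rfl, by rw [endVertex_concat, endVertex_concat], ?_⟩
  rcases h' with rfl | ⟨hn, h'⟩
  · exact .inl rfl
  · refine .inr ⟨?_, ?_⟩
    · rw [endVertex_append]
      exact hn.endVertex ⟨he, trivial⟩
    · rcases h' with ⟨s, rfl⟩ | ⟨s, rfl⟩
      · rw [isChainFrom_append] at hb
        rw [List.append_assoc, List.prefix_append_right_inj, List.prefix_append_right_inj]
        refine hn.prefix_or_prefix ⟨he, trivial⟩ ((isChainFrom_append _ _ _).2 ⟨hb.2, ?_⟩)
        rw [endVertex_append] at h
        exact ⟨he.trans h, trivial⟩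
      · rw [isChainFrom_append] at ha
        rw [List.append_assoc, List.prefix_append_right_inj, List.prefix_append_right_inj]
        rw [h] at hn
        refine hn.prefix_or_prefix ((isChainFrom_append _ _ _).2 ⟨ha.2, ?_⟩) ⟨he.trans h, trivial⟩
        rw [endVertex_append] at he
        exact ⟨he, trivial⟩

/-- If `α e ≠ β e`, the shorter one is a prefix of the longer one without its last edge, say `β = α
e s`. So `r(α) = r(β)` is reached from `r(e)`, and it inherits the absence of exits. -/
theorem Aligned.of_concat {x y : V} {a b : List D} (ha : E.IsChainFrom x a)
    (hb : E.IsChainFrom y b) (hab : E.endVertex x a = E.endVertex y b) {e : D}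
    (h : E.Aligned x (a ++ [e]) y (b ++ [e])) : E.Aligned x a y b := by
  obtain ⟨rfl, -, h⟩ := h
  rw [endVertex_concat] at h
  refine ⟨rfl, hab, ?_⟩
  by_cases h' : a = b
  · exact .inl h'
  · have hne : a ++ [e] ≠ b ++ [e] := fun h => h' (List.append_cancel_right h)
    obtain ⟨hn, h⟩ := h.resolve_left hne
    rw [List.prefix_concat_iff, List.prefix_concat_iff] at h
    rcases h with (h | ⟨s, rfl⟩) | (h | ⟨s, rfl⟩)
    · exact absurd h hne
    · rw [isChainFrom_append, endVertex_concat] at hb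
      rw [hab, endVertex_append, endVertex_concat]
      exact .inr ⟨hn.endVertex hb.2, .inl (by simp)⟩
    · exact absurd h.symm hne
    · rw [isChainFrom_append, endVertex_concat] at ha
      rw [endVertex_append, endVertex_concat]
      exact .inr ⟨hn.endVertex ha.2, .inr (by simp)⟩

/-- With one edge this is compatibility with (CK2); with longer `c` it decides alignment in products
of generators. -/
theorem aligned_append {x y : V} {a b c : List D} (ha : E.IsChainFrom x a)
    (hb : E.IsChainFrom y b) (hab : E.endVertex x a = E.endVertex y b)
    (hc : E.IsChainFrom (E.endVertex x a) c) :
    E.Aligned x (a ++ c) y (b ++ c) ↔ E.Aligned x a y b := by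
  induction c generalizing a b with
  | nil => simp
  | cons e c ih =>
    rw [List.append_cons a, List.append_cons b, ih]
    · exact ⟨Aligned.of_concat ha hb hab, fun h => h.concat ha hb hc.1⟩
    · exact (isChainFrom_concat _ _ _).2 ⟨ha, hc.1⟩
    · exact (isChainFrom_concat _ _ _).2 ⟨hb, hc.1.trans hab⟩
    · rw [endVertex_concat, endVertex_concat]
    · rw [endVertex_concat]
      exact hc.2

end DirectedGraph

/-! ### Products of paths, and normality as alignment. -/

namespace LeavittPathAlgebra

section PathProducts

variable (R : Type w) [CommRing R] {V : Type u} {D : Type v} {E : DirectedGraph V D}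

theorem vertex_mul_ofEdges {x : V} {a : List D} (ha : E.IsChainFrom x a) :
    of R E (vertex x) * ofEdges R E x a = ofEdges R E x a := by
  cases a with
  | nil => exact of_rel (.vertex_idem x)
  | cons e a =>
    obtain ⟨rfl, -⟩ := ha
    rw [ofEdges, ← mul_assoc, of_rel (.source_edge e)]

theorem vertex_mul_ofEdges_of_ne {x y : V} (h : y ≠ x) {a : List D} (ha : E.IsChainFrom x a) :
    of R E (vertex y) * ofEdges R E x a = 0 := by
  rw [← vertex_mul_ofEdges R ha, ← mul_assoc, of_rel (.vertex_orth y x h), zero_mul]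

theorem ofEdges_append {x : V} {a b : List D} (h : E.IsChainFrom x (a ++ b)) :
    ofEdges R E x (a ++ b) = ofEdges R E x a * ofEdges R E (E.endVertex x a) b := by
  induction a generalizing x with
  | nil => exact (vertex_mul_ofEdges R h).symm
  | cons e a ih => rw [List.cons_append, ofEdges, ih h.2, ofEdges, mul_assoc]; rfl

theorem star_vertex (x : V) : star (of R E (vertex x)) = of R E (vertex x) := star_of R E _

theorem ofEdges_mul_vertex {x : V} {a : List D} (h : E.IsChainFrom x a) :
    ofEdges R E x a * of R E (vertex (E.endVertex x a)) = ofEdges R E x a := by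
  have := ofEdges_append R (a := a) (b := []) (by simpa using h)
  rw [List.append_nil] at this
  exact this.symm

theorem star_ofEdges_mul_self {x : V} {a : List D} (h : E.IsChainFrom x a) :
    star (ofEdges R E x a) * ofEdges R E x a = of R E (vertex (E.endVertex x a)) := by
  induction a generalizing x with
  | nil => rw [star_ofEdges_nil]; exact of_rel (.vertex_idem x)
  | cons e a ih =>
    rw [star_ofEdges_cons, ofEdges, mul_assoc, ← mul_assoc (of R E (ghost e)),
      of_rel (.ck1_self e), vertex_mul_ofEdges R h.2, ih h.2]
    rfl

theorem star_ofEdges_mul_append {x : V} {a c : List D} (h : E.IsChainFrom x (a ++ c)) :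
    star (ofEdges R E x a) * ofEdges R E x (a ++ c) = ofEdges R E (E.endVertex x a) c := by
  rw [ofEdges_append R h]
  rw [isChainFrom_append] at h
  rw [← mul_assoc, star_ofEdges_mul_self R h.1, vertex_mul_ofEdges R h.2]

theorem star_ofEdges_append_mul {x : V} {a c : List D} (h : E.IsChainFrom x (a ++ c)) :
    star (ofEdges R E x (a ++ c)) * ofEdges R E x a = star (ofEdges R E (E.endVertex x a) c) := by
  rw [← star_ofEdges_mul_append R h, star_mul, star_star]

/-- Incomparable paths have different sources or differ at a first edge, where (CK1) or
orthogonality of the vertices gives zero. -/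
theorem star_ofEdges_mul_eq_zero {x y : V} {a b : List D} (ha : E.IsChainFrom x a)
    (hb : E.IsChainFrom y b) (h : ¬ (x = y ∧ (a <+: b ∨ b <+: a))) :
    star (ofEdges R E x a) * ofEdges R E y b = 0 := by
  by_cases hxy : x = y
  · subst hxy
    have h : ¬ (a <+: b ∨ b <+: a) := fun h' => h ⟨rfl, h'⟩
    induction a generalizing x b with
    | nil => simp at h
    | cons e a ih =>
      cases b with
      | nil => simp at h
      | cons f b =>
        rw [star_ofEdges_cons, ofEdges, mul_assoc, ← mul_assoc (of R E (ghost e))]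
        by_cases hef : e = f
        · subst hef
          rw [of_rel (.ck1_self e), vertex_mul_ofEdges R hb.2]
          refine ih ha.2 hb.2 ?_ ?_ <;> simpa [List.cons_prefix_cons] using h
        · rw [of_rel (.ck1_ne e f hef), zero_mul, mul_zero]
  · rw [← vertex_mul_ofEdges R ha, star_mul, star_vertex, mul_assoc,
      vertex_mul_ofEdges_of_ne R hxy hb, mul_zero]

/-- Every vertex that `c` leaves emits a single edge `e`, so (CK2) reads `s(e) = e e*` there. -/
theorem ofEdges_mul_star_self_of_noExits {x : V} (hx : E.NoExits x) {c : List D}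
    (hc : E.IsChainFrom x c) :
    ofEdges R E x c * star (ofEdges R E x c) = of R E (vertex x) := by
  induction c generalizing x with
  | nil => rw [star_ofEdges_nil]; exact of_rel (.vertex_idem x)
  | cons e c ih =>
    obtain ⟨rfl, hc⟩ := hc
    have hr : E.NoExits (E.range e) := hx.endVertex (c := [e]) ⟨rfl, trivial⟩
    rw [star_ofEdges_cons, ofEdges, mul_assoc, ← mul_assoc (ofEdges R E _ _), ih hr hc,
      of_rel (.range_ghost e)]
    have hs : {f : D | E.source f = E.source e} = {e} :=
      Set.ext fun f => ⟨fun hf => hx [] trivial f e hf rfl, fun hf => congrArg E.source hf⟩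
    have hfin : {f : D | E.source f = E.source e}.Finite := hs ▸ Set.finite_singleton e
    have hfin' : hfin.toFinset = {e} := by ext f; simpa using Set.ext_iff.1 hs f
    rw [of_rel (.ck2 (E.source e) hfin ⟨e, rfl⟩), hfin', Finset.sum_singleton]

theorem proj_append_of_noExits {x : V} {a c : List D} (hn : E.NoExits (E.endVertex x a))
    (hc : E.IsChainFrom x (a ++ c)) :
    ofEdges R E x (a ++ c) * star (ofEdges R E x (a ++ c)) =
      ofEdges R E x a * star (ofEdges R E x a) := by
  rw [ofEdges_append R hc, star_mul, mul_assoc, ← mul_assoc (ofEdges R E (E.endVertex x a) c)]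
  rw [isChainFrom_append] at hc
  rw [ofEdges_mul_star_self_of_noExits R hn hc.2, ← mul_assoc, ofEdges_mul_vertex R hc.1]

theorem Aligned.mul_star_eq {x y : V} {a b : List D} (ha : E.IsChainFrom x a)
    (hb : E.IsChainFrom y b) (h : E.Aligned x a y b) :
    ofEdges R E x a * star (ofEdges R E x a) = ofEdges R E y b * star (ofEdges R E y b) := by
  obtain ⟨rfl, hab, rfl | ⟨hn, ⟨c, rfl⟩ | ⟨c, rfl⟩⟩⟩ := h
  · rfl
  · exact (proj_append_of_noExits R hn hb).symm
  · exact proj_append_of_noExits R (hab ▸ hn) ha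

theorem std_mul_star {x y : V} {a b : List D} (ha : E.IsChainFrom x a) (hb : E.IsChainFrom y b)
    (hab : E.endVertex x a = E.endVertex y b) :
    (ofEdges R E x a * star (ofEdges R E y b)) * star (ofEdges R E x a * star (ofEdges R E y b)) =
      ofEdges R E x a * star (ofEdges R E x a) := by
  rw [star_mul, star_star, mul_assoc, ← mul_assoc (star (ofEdges R E y b)),
    star_ofEdges_mul_self R hb, ← hab, ← mul_assoc, ofEdges_mul_vertex R ha]

theorem star_mul_std {x y : V} {a b : List D} (ha : E.IsChainFrom x a) (hb : E.IsChainFrom y b)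
    (hab : E.endVertex x a = E.endVertex y b) :
    star (ofEdges R E x a * star (ofEdges R E y b)) * (ofEdges R E x a * star (ofEdges R E y b)) =
      ofEdges R E y b * star (ofEdges R E y b) := by
  have := std_mul_star R hb ha hab.symm
  rwa [star_mul, star_star] at this ⊢

theorem exists_selection (E : DirectedGraph V D) : ∃ sel : D → Prop, ∀ x : V,
    (∃ e, E.source e = x) → ∃ e, E.source e = x ∧ sel e ∧ ∀ f, E.source f = x → sel f → f = e := by
  refine ⟨fun e => (⟨e, rfl⟩ : ∃ f, E.source f = E.source e).choose = e, ?_⟩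
  rintro _ ⟨e, rfl⟩
  -- The chosen edge depends only on the predicate "has this source", so edges with the same source
  -- select the same edge.
  have h : ∃ f, E.source f = E.source e := ⟨e, rfl⟩
  have key : ∀ f, E.source f = E.source e →
      (⟨f, rfl⟩ : ∃ g, E.source g = E.source f).choose = h.choose := by
    intro f hf
    congr 1
    funext g
    rw [hf]
  refine ⟨h.choose, h.choose_spec, key _ h.choose_spec, fun f hf hf' => ?_⟩
  rw [← hf', key f hf]

/-- A functional detects `x`: it is `1` on `α α*` when `α` starts at `x` and uses only selected
edges, and `0` on all other pairs of paths. One selected edge at each emitting vertex makes both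
sides of (CK2) agree. -/
theorem of_vertex_ne_zero [Nontrivial R] (x : V) : of R E (vertex x) ≠ 0 := by
  classical
  obtain ⟨sel, hsel⟩ := exists_selection E
  obtain ⟨T, hT⟩ := exists_linearMap (R := R) (E := E) (N := R)
    (fun y a z b => if y = x ∧ z = x ∧ a = b ∧ ∀ e ∈ a, sel e then 1 else 0) (by
      intro y a z b ha hb hab hfin hne
      obtain ⟨e, he, hes, huniq⟩ := hsel _ hne
      rw [Finset.sum_eq_single e]
      · simp only [List.append_cancel_right_eq, List.mem_append, List.mem_singleton]
        congr 1
        simp only [eq_iff_iff]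
        grind
      · intro f hf hfe
        rw [if_neg]
        rintro ⟨-, -, -, h⟩
        exact hfe (huniq f (by simpa using hf) (h f (by simp)))
      · intro h
        exact absurd (hfin.mem_toFinset.2 he) h)
  intro h
  have := hT x [] x [] trivial trivial rfl
  rw [ofEdges, h] at this
  simp at this

/-- A path `d` from `x` satisfies `d = c c* d`, which would be zero if `d` and `c` were
incomparable, whereas `d* d` is a nonzero vertex. Hence there is at most one path of each length
from `x`. -/
theorem NoExits.of_mul_star_self [Nontrivial R] {x : V} {c : List D} (hc : E.IsChainFrom x c)
    (hne : c ≠ []) (hx : E.endVertex x c = x)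
    (h : ofEdges R E x c * star (ofEdges R E x c) = of R E (vertex x)) : E.NoExits x := by
  have hcmp : ∀ d, E.IsChainFrom x d → d <+: c ∨ c <+: d := by
    intro d hd
    by_contra hdc
    refine of_vertex_ne_zero R (E := E) (E.endVertex x d) ?_
    have h0 := star_ofEdges_mul_eq_zero R hc hd fun h => hdc h.2.symm
    have hd0 : ofEdges R E x d = 0 := by
      rw [← vertex_mul_ofEdges R hd, ← h, mul_assoc, h0, mul_zero]
    rw [← star_ofEdges_mul_self R hd, hd0, mul_zero]
  have key : ∀ n : ℕ, ∀ d d', E.IsChainFrom x d → E.IsChainFrom x d' → d.length = n →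
      d'.length = n → d = d' := by
    intro n
    induction n using Nat.strong_induction_on with
    | _ n ih =>
      intro d d' hd hd' hn hn'
      -- Short paths are prefixes of `c`. A longer one begins with `c`, and since `c` returns to
      -- `x`, what remains is a shorter path from `x`.
      by_cases hle : n ≤ c.length
      · have h1 : d <+: c := by
          rcases hcmp d hd with h | h
          · exact h
          · rw [h.eq_of_length (by have := h.length_le; omega)]
        have h2 : d' <+: c := by
          rcases hcmp d' hd' with h | h
          · exact h
          · rw [h.eq_of_length (by have := h.length_le; omega)]
        exact (List.prefix_of_prefix_length_le h1 h2 (by omega)).eq_of_length (by omega)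
      · have h1 : c <+: d := (hcmp d hd).resolve_left fun h => by have := h.length_le; omega
        have h2 : c <+: d' := (hcmp d' hd').resolve_left fun h => by have := h.length_le; omega
        obtain ⟨s, rfl⟩ := h1
        obtain ⟨s', rfl⟩ := h2
        rw [isChainFrom_append, hx] at hd hd'
        rw [List.length_append] at hn hn'
        have hpos := List.length_pos_iff.2 hne
        rw [ih s.length (by omega) s s' hd.2 hd'.2 rfl (by omega)]
  intro d hd e f he hf
  have := key _ (d ++ [e]) (d ++ [f]) ((isChainFrom_concat _ _ _).2 ⟨hd, he⟩)
    ((isChainFrom_concat _ _ _).2 ⟨hd, hf⟩) rfl (by simp)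
  simpa using this

theorem Aligned.of_mul_star_eq [Nontrivial R] {x y : V} {a b : List D} (ha : E.IsChainFrom x a)
    (hb : E.IsChainFrom y b) (hab : E.endVertex x a = E.endVertex y b)
    (h : ofEdges R E x a * star (ofEdges R E x a) = ofEdges R E y b * star (ofEdges R E y b)) :
    E.Aligned x a y b := by
  have key : ∀ {a c : List D}, E.IsChainFrom x (a ++ c) →
      E.endVertex x a = E.endVertex x (a ++ c) → ofEdges R E x a * star (ofEdges R E x a) =
        ofEdges R E x (a ++ c) * star (ofEdges R E x (a ++ c)) →
      E.Aligned x a x (a ++ c) := by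
    intro a c hc hac h
    refine ⟨rfl, hac, ?_⟩
    by_cases hne : c = []
    · simp [hne]
    rw [ofEdges_append R hc, star_mul] at h
    rw [isChainFrom_append] at hc
    rw [endVertex_append] at hac
    -- Compression by `α` turns `α α* = (α c)(α c)*` into `r(α) = c c*`.
    have h' := congrArg (fun z => star (ofEdges R E x a) * z * ofEdges R E x a) h
    simp only [mul_assoc, star_ofEdges_mul_self R hc.1] at h'
    simp only [← mul_assoc, star_ofEdges_mul_self R hc.1] at h'
    rw [vertex_mul_ofEdges R hc.2, mul_assoc, of_rel (.vertex_idem _),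
      ← star_vertex R (E.endVertex x a), ← star_mul, star_vertex, vertex_mul_ofEdges R hc.2] at h'
    exact .inr ⟨NoExits.of_mul_star_self R hc.2 hne hac.symm h'.symm, .inl (by simp)⟩
  by_cases hc : x = y ∧ (a <+: b ∨ b <+: a)
  · obtain ⟨rfl, ⟨c, rfl⟩ | ⟨c, rfl⟩⟩ := hc
    · exact key hb hab h
    · exact (key ha hab.symm h.symm).symm
  · exfalso
    refine of_vertex_ne_zero R (E := E) (E.endVertex x a) ?_
    have h0 := star_ofEdges_mul_eq_zero R hb ha fun h => hc ⟨h.1.symm, h.2.symm⟩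
    have ha0 : ofEdges R E x a = 0 := by
      rw [← ofEdges_mul_vertex R ha, ← star_ofEdges_mul_self R ha, ← mul_assoc, h, mul_assoc, h0,
        mul_zero]
    rw [← star_ofEdges_mul_self R ha, ha0, mul_zero]

end PathProducts

end LeavittPathAlgebra

/-! ### The projection onto the commutative core and its bimodule property. -/

namespace LeavittPathAlgebra

section CoreProjection

variable (R : Type w) [CommRing R] {V : Type u} {D : Type v} {E : DirectedGraph V D}

theorem ofEdges_mul_star_mem {x y : V} {a b : List D} (ha : E.IsChainFrom x a)
    (hb : E.IsChainFrom y b) (hab : E.endVertex x a = E.endVertex y b) :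
    ofEdges R E x a * star (ofEdges R E y b) ∈ stdGenerators R E :=
  ⟨⟨x, a, ha⟩, ⟨y, b, hb⟩, hab, rfl⟩

theorem Aligned.mem_normalGenerators {x y : V} {a b : List D} (ha : E.IsChainFrom x a)
    (hb : E.IsChainFrom y b) (h : E.Aligned x a y b) :
    ofEdges R E x a * star (ofEdges R E y b) ∈ normalGenerators R E :=
  ⟨ofEdges_mul_star_mem R ha hb h.2.1, by
    rw [std_mul_star R ha hb h.2.1, star_mul_std R ha hb h.2.1, Aligned.mul_star_eq R ha hb h]⟩

theorem Aligned.mem_core {x y : V} {a b : List D} (ha : E.IsChainFrom x a)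
    (hb : E.IsChainFrom y b) (h : E.Aligned x a y b) :
    ofEdges R E x a * star (ofEdges R E y b) ∈ core R E :=
  NonUnitalAlgebra.subset_adjoin R (Aligned.mem_normalGenerators R ha hb h)

theorem exists_aligned_of_mem_normalGenerators [Nontrivial R] {z : LeavittPathAlgebra R E}
    (hz : z ∈ normalGenerators R E) : ∃ x a y b, E.IsChainFrom x a ∧ E.IsChainFrom y b ∧
      E.Aligned x a y b ∧ z = ofEdges R E x a * star (ofEdges R E y b) := by
  obtain ⟨⟨⟨x, a, ha⟩, ⟨y, b, hb⟩, hab, rfl⟩, hn⟩ := hz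
  simp only [FinPath.range] at hab
  simp only [ofPath] at hn
  rw [std_mul_star R ha hb hab, star_mul_std R ha hb hab] at hn
  exact ⟨x, a, y, b, ha, hb, Aligned.of_mul_star_eq R ha hb hab hn, rfl⟩

theorem ofEdges_mul_star_eq_sum {x y : V} {a b : List D} (ha : E.IsChainFrom x a)
    (hb : E.IsChainFrom y b) (hab : E.endVertex x a = E.endVertex y b)
    (hfin : {e : D | E.source e = E.endVertex y b}.Finite)
    (hne : {e : D | E.source e = E.endVertex y b}.Nonempty) :
    ofEdges R E x a * star (ofEdges R E y b) =
      ∑ e ∈ hfin.toFinset, ofEdges R E x (a ++ [e]) * star (ofEdges R E y (b ++ [e])) := by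
  conv_lhs => rw [← ofEdges_mul_vertex R ha, hab, of_rel (.ck2 _ hfin hne), Finset.mul_sum,
    Finset.sum_mul]
  refine Finset.sum_congr rfl fun e he => ?_
  have he : E.source e = E.endVertex y b := by simpa using he
  have hedge : ∀ v : V, ofEdges R E v [e] = of R E (edge e) := fun _ => of_rel (.edge_range e)
  rw [ofEdges_append R ((isChainFrom_concat _ _ _).2 ⟨ha, he.trans hab.symm⟩),
    ofEdges_append R ((isChainFrom_concat _ _ _).2 ⟨hb, he⟩), hedge, hedge, star_mul, star_of]
  simp only [mul_assoc]
  rfl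

theorem of_mul_mem_span (g : LeavittGen V D) {z : LeavittPathAlgebra R E}
    (hz : z ∈ Submodule.span R (stdGenerators R E)) :
    of R E g * z ∈ Submodule.span R (stdGenerators R E) := by
  induction hz using Submodule.span_induction with
  | zero => simp
  | add z z' _ _ hz hz' => rw [mul_add]; exact add_mem hz hz'
  | smul c z _ hz => rw [mul_smul_comm]; exact Submodule.smul_mem _ c hz
  | mem z hz =>
    obtain ⟨⟨x, a, ha⟩, ⟨y, b, hb⟩, hab, rfl⟩ := hz
    simp only [FinPath.range] at hab
    simp only [ofPath, ← mul_assoc]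
    cases g with
    | vertex v =>
      by_cases h : v = x
      · subst h
        rw [vertex_mul_ofEdges R ha]
        exact Submodule.subset_span (ofEdges_mul_star_mem R ha hb hab)
      · rw [vertex_mul_ofEdges_of_ne R h ha, zero_mul]
        exact zero_mem _
    | edge e =>
      by_cases h : E.range e = x
      · subst h
        exact Submodule.subset_span
          (ofEdges_mul_star_mem R (x := E.source e) (a := e :: a) ⟨rfl, ha⟩ hb hab)
      · rw [← of_rel (.edge_range e), mul_assoc (of R E (edge e)),
          vertex_mul_ofEdges_of_ne R h ha, mul_zero, zero_mul]
        exact zero_mem _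
    | ghost e =>
      by_cases h : E.source e = x
      · subst h
        cases a with
        -- In this case `e* β* = r(e) (β e)*`.
        | nil =>
          have hab : E.source e = E.endVertex y b := hab
          have hc := (isChainFrom_concat y b e).2 ⟨hb, hab⟩
          have := ofEdges_mul_star_mem R (x := E.range e) (a := []) trivial hc
            (endVertex_concat y b e).symm
          rw [ofEdges_append R hc, star_mul, star_ofEdges_cons, star_ofEdges_nil,
            of_rel (.range_ghost e), ofEdges, ← mul_assoc, of_rel (.range_ghost e)] at this
          rw [ofEdges, of_rel (.ghost_source e)]
          exact Submodule.subset_span this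
        | cons f a =>
          rw [ofEdges, ← mul_assoc]
          by_cases hf : e = f
          · subst hf
            rw [of_rel (.ck1_self e), vertex_mul_ofEdges R ha.2]
            exact Submodule.subset_span (ofEdges_mul_star_mem R ha.2 hb hab)
          · rw [of_rel (.ck1_ne e f hf), zero_mul, zero_mul]
            exact zero_mem _
      · rw [← of_rel (.ghost_source e), mul_assoc (of R E (ghost e)),
          vertex_mul_ofEdges_of_ne R h ha, mul_zero, zero_mul]
        exact zero_mem _

theorem of_mem_span (g : LeavittGen V D) :
    of R E g ∈ Submodule.span R (stdGenerators R E) := by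
  have hv : ∀ x : V, of R E (vertex x) ∈ Submodule.span R (stdGenerators R E) := fun x => by
    have := ofEdges_mul_star_mem R (E := E) (x := x) (y := x) (a := []) (b := []) trivial trivial rfl
    rw [star_ofEdges_nil, ofEdges, of_rel (.vertex_idem x)] at this
    exact Submodule.subset_span this
  cases g with
  | vertex x => exact hv x
  | edge e => rw [← of_rel (.edge_range e)]; exact of_mul_mem_span R _ (hv _)
  | ghost e => rw [← of_rel (.ghost_source e)]; exact of_mul_mem_span R _ (hv _)

theorem mem_span_stdGenerators (z : LeavittPathAlgebra R E) :
    z ∈ Submodule.span R (stdGenerators R E) := by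
  have key : ∀ s : FreeSemigroup (LeavittGen V D),
      mk R E (MonoidAlgebra.single s 1) ∈ Submodule.span R (stdGenerators R E) := by
    intro s
    induction s using FreeSemigroup.recOnMul with
    | ih1 g => exact of_mem_span R g
    | ih2 g s _ hs =>
      have : (MonoidAlgebra.single (FreeSemigroup.of g * s) 1 : LeavittFree R V D) =
          leavittFreeOf R g * MonoidAlgebra.single s 1 := by
        rw [leavittFreeOf, MonoidAlgebra.single_mul_single, one_mul]
      rw [this, mk_mul]
      exact of_mul_mem_span R g hs
  obtain ⟨f, rfl⟩ := mk_surjective R E z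
  induction f using MonoidAlgebra.induction_linear with
  | zero => exact zero_mem _
  | add f g hf hg => rw [mk_add]; exact add_mem hf hg
  | single s c =>
    have : (MonoidAlgebra.single s c : LeavittFree R V D) = c • MonoidAlgebra.single s 1 := by
      rw [MonoidAlgebra.smul_single, smul_eq_mul, mul_one]
    rw [this, mk_smul]
    exact Submodule.smul_mem _ c (key s)

theorem std_induction {p : LeavittPathAlgebra R E → Prop}
    (std : ∀ x a y b, E.IsChainFrom x a → E.IsChainFrom y b → E.endVertex x a = E.endVertex y b →
      p (ofEdges R E x a * star (ofEdges R E y b)))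
    (zero : p 0) (add : ∀ z z', p z → p z' → p (z + z')) (smul : ∀ (c : R) z, p z → p (c • z))
    (z : LeavittPathAlgebra R E) : p z := by
  induction mem_span_stdGenerators R z using Submodule.span_induction with
  | zero => exact zero
  | add z z' _ _ hz hz' => exact add z z' hz hz'
  | smul c z _ hz => exact smul c z hz
  | mem z hz =>
    obtain ⟨⟨x, a, ha⟩, ⟨y, b, hb⟩, hab, rfl⟩ := hz
    exact std x a y b ha hb hab

open Classical in
variable (E) in
theorem exists_coreProj : ∃ T : LeavittPathAlgebra R E →ₗ[R] LeavittPathAlgebra R E,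
    ∀ x a y b, E.IsChainFrom x a → E.IsChainFrom y b → E.endVertex x a = E.endVertex y b →
      T (ofEdges R E x a * star (ofEdges R E y b)) =
        if E.Aligned x a y b then ofEdges R E x a * star (ofEdges R E y b) else 0 := by
  refine exists_linearMap (fun x a y b =>
    if E.Aligned x a y b then ofEdges R E x a * star (ofEdges R E y b) else 0) ?_
  intro x a y b ha hb hab hfin hne
  have hal : ∀ e ∈ hfin.toFinset, E.Aligned x (a ++ [e]) y (b ++ [e]) ↔ E.Aligned x a y b := by
    intro e he
    have he : E.source e = E.endVertex y b := by simpa using he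
    exact aligned_append ha hb hab ⟨he.trans hab.symm, trivial⟩
  split_ifs with h
  · rw [ofEdges_mul_star_eq_sum R ha hb hab hfin hne]
    exact Finset.sum_congr rfl fun e he => (if_pos ((hal e he).2 h)).symm
  · exact (Finset.sum_eq_zero fun e he => if_neg fun h' => h ((hal e he).1 h')).symm

variable (E) in
/-- The linear map which fixes the elements `α β*` with `α`, `β` aligned and annihilates the other
elements `α β*`. -/
noncomputable def coreProj : LeavittPathAlgebra R E →ₗ[R] LeavittPathAlgebra R E :=
  (exists_coreProj R E).choose

theorem coreProj_of_aligned {x y : V} {a b : List D} (ha : E.IsChainFrom x a)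
    (hb : E.IsChainFrom y b) (h : E.Aligned x a y b) :
    coreProj R E (ofEdges R E x a * star (ofEdges R E y b)) =
      ofEdges R E x a * star (ofEdges R E y b) :=
  ((exists_coreProj R E).choose_spec x a y b ha hb h.2.1).trans (if_pos h)

theorem coreProj_of_not_aligned {x y : V} {a b : List D} (ha : E.IsChainFrom x a)
    (hb : E.IsChainFrom y b) (hab : E.endVertex x a = E.endVertex y b)
    (h : ¬ E.Aligned x a y b) :
    coreProj R E (ofEdges R E x a * star (ofEdges R E y b)) = 0 :=
  ((exists_coreProj R E).choose_spec x a y b ha hb hab).trans (if_neg h)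

theorem coreProj_mem (z : LeavittPathAlgebra R E) : coreProj R E z ∈ core R E := by
  induction z using std_induction with
  | zero => rw [map_zero]; exact zero_mem _
  | add z z' hz hz' => rw [map_add]; exact add_mem hz hz'
  | smul c z hz => rw [map_smul]; exact SMulMemClass.smul_mem c hz
  | std x a y b ha hb hab =>
    by_cases h : E.Aligned x a y b
    · rw [coreProj_of_aligned R ha hb h]
      exact Aligned.mem_core R ha hb h
    · rw [coreProj_of_not_aligned R ha hb hab h]
      exact zero_mem _

theorem coreProj_star (z : LeavittPathAlgebra R E) :
    coreProj R E (star z) = star (coreProj R E z) := by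
  induction z using std_induction with
  | zero => simp
  | add z z' hz hz' => rw [star_add, map_add, map_add, star_add, hz, hz']
  | smul c z hz => rw [star_smul', map_smul, map_smul, star_smul', hz]
  | std x a y b ha hb hab =>
    rw [star_mul, star_star]
    by_cases h : E.Aligned x a y b
    · rw [coreProj_of_aligned R ha hb h, coreProj_of_aligned R hb ha h.symm, star_mul, star_star]
    · rw [coreProj_of_not_aligned R ha hb hab h,
        coreProj_of_not_aligned R hb ha hab.symm fun h' => h h'.symm, star_zero]

theorem core_induction {p : ∀ z, z ∈ core R E → Prop}
    (std : ∀ x a y b (ha : E.IsChainFrom x a) (hb : E.IsChainFrom y b) (h : E.Aligned x a y b),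
      p (ofEdges R E x a * star (ofEdges R E y b)) (Aligned.mem_core R ha hb h))
    (zero : p 0 (zero_mem _))
    (add : ∀ z z' hz hz', p z hz → p z' hz' → p (z + z') (add_mem hz hz'))
    (smul : ∀ (c : R) z hz, p z hz → p (c • z) (SMulMemClass.smul_mem c hz))
    (mul : ∀ z z' hz hz', p z hz → p z' hz' → p (z * z') (mul_mem hz hz'))
    {z : LeavittPathAlgebra R E} (hz : z ∈ core R E) : p z hz := by
  -- Normality forces alignment only over a nontrivial ring; over the zero ring the algebra is zero.
  rcases subsingleton_or_nontrivial R with _ | _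
  · have := Module.subsingleton R (LeavittPathAlgebra R E)
    obtain rfl := Subsingleton.elim 0 z
    exact zero
  change z ∈ NonUnitalAlgebra.adjoin R (normalGenerators R E) at hz
  induction hz using NonUnitalAlgebra.adjoin_induction with
  | zero => exact zero
  | add z z' hz hz' h h' => exact add z z' hz hz' h h'
  | smul c z hz h => exact smul c z hz h
  | mul z z' hz hz' h h' => exact mul z z' hz hz' h h'
  | mem z hz =>
    obtain ⟨x, a, y, b, ha, hb, hab, rfl⟩ := exists_aligned_of_mem_normalGenerators R hz
    exact std x a y b ha hb hab

/-- If `γ = β k`, the product of `α β*` and `γ δ*` is `(α k) δ*`, and `α k` is aligned with `β k =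
γ`. If `β = γ k`, it is `α (δ k)*`, and `α` is aligned with `γ k`. By transitivity and cancellation
of `k`, the product is aligned exactly when `γ` and `δ` are. Otherwise the product is zero. -/
theorem coreProj_aligned_mul {x y : V} {a b : List D} (ha : E.IsChainFrom x a)
    (hb : E.IsChainFrom y b) (h : E.Aligned x a y b) (z : LeavittPathAlgebra R E) :
    coreProj R E (ofEdges R E x a * star (ofEdges R E y b) * z) =
      ofEdges R E x a * star (ofEdges R E y b) * coreProj R E z := by
  have hab := h.2.1
  induction z using std_induction with
  | zero => simp
  | add z z' hz hz' => rw [mul_add, map_add, map_add, mul_add, hz, hz']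
  | smul r z hz => rw [mul_smul_comm, map_smul, map_smul, mul_smul_comm, hz]
  | std x' c y' d hc hd hcd =>
    have key : ∀ {x₁ y₁ : V} {a₁ b₁ : List D}, E.IsChainFrom x₁ a₁ → E.IsChainFrom y₁ b₁ →
        E.endVertex x₁ a₁ = E.endVertex y₁ b₁ →
        ofEdges R E x a * star (ofEdges R E y b) *
          (ofEdges R E x' c * star (ofEdges R E y' d)) =
            ofEdges R E x₁ a₁ * star (ofEdges R E y₁ b₁) →
        (E.Aligned x₁ a₁ y₁ b₁ ↔ E.Aligned x' c y' d) →
        coreProj R E (ofEdges R E x a * star (ofEdges R E y b) *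
          (ofEdges R E x' c * star (ofEdges R E y' d))) =
        ofEdges R E x a * star (ofEdges R E y b) *
          coreProj R E (ofEdges R E x' c * star (ofEdges R E y' d)) := by
      intro x₁ y₁ a₁ b₁ h₁ h₂ h₁₂ heq hiff
      by_cases h' : E.Aligned x' c y' d
      · rw [heq, coreProj_of_aligned R h₁ h₂ (hiff.2 h'), coreProj_of_aligned R hc hd h', heq]
      · rw [heq, coreProj_of_not_aligned R h₁ h₂ h₁₂ fun h => h' (hiff.1 h),
          coreProj_of_not_aligned R hc hd hcd h', mul_zero]
    by_cases hbc : y = x' ∧ (b <+: c ∨ c <+: b)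
    · obtain ⟨rfl, ⟨k, rfl⟩ | ⟨k, rfl⟩⟩ := hbc
      · have hk := (isChainFrom_append _ _ _).1 hc
        have hak : E.IsChainFrom x (a ++ k) := (isChainFrom_append _ _ _).2 ⟨ha, by
          rw [hab]; exact hk.2⟩
        have hakc : E.Aligned x (a ++ k) y (b ++ k) :=
          (aligned_append ha hb hab (hab ▸ hk.2)).2 h
        refine key hak hd (hakc.2.1.trans hcd) ?_
          ⟨fun h' => hakc.symm.trans hc hd h', fun h' => hakc.trans hak hd h'⟩
        rw [mul_assoc, ← mul_assoc (star (ofEdges R E y b)), star_ofEdges_mul_append R hc,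
          ofEdges_append R hak, hab, mul_assoc]
      · have hk := (isChainFrom_append _ _ _).1 hb
        have hdk : E.IsChainFrom y' (d ++ k) := (isChainFrom_append _ _ _).2 ⟨hd, by
          rw [← hcd]; exact hk.2⟩
        have hend : E.endVertex y (c ++ k) = E.endVertex y' (d ++ k) := by
          rw [endVertex_append, endVertex_append, hcd]
        refine key ha hdk (hab.trans hend) ?_ ?_
        · rw [mul_assoc, ← mul_assoc (star (ofEdges R E y (c ++ k))),
            star_ofEdges_append_mul R hb, ofEdges_append R hdk, star_mul, hcd]
        · rw [← aligned_append hc hd hcd hk.2]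
          exact ⟨fun h' => h.symm.trans hb hdk h', fun h' => h.trans ha hdk h'⟩
    · have h0 : ofEdges R E x a * star (ofEdges R E y b) *
          (ofEdges R E x' c * star (ofEdges R E y' d)) = 0 := by
        rw [mul_assoc, ← mul_assoc (star (ofEdges R E y b)),
          star_ofEdges_mul_eq_zero R hb hc hbc, zero_mul, mul_zero]
      by_cases h' : E.Aligned x' c y' d
      · rw [coreProj_of_aligned R hc hd h', h0, map_zero]
      · rw [coreProj_of_not_aligned R hc hd hcd h', h0, map_zero, mul_zero]

theorem coreProj_mul_left {b : LeavittPathAlgebra R E} (hb : b ∈ core R E)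
    (z : LeavittPathAlgebra R E) : coreProj R E (b * z) = b * coreProj R E z := by
  induction hb using core_induction generalizing z with
  | zero => simp
  | add b b' _ _ hb hb' => rw [add_mul, map_add, hb, hb', add_mul]
  | smul c b _ hb => rw [smul_mul_assoc, map_smul, hb, smul_mul_assoc]
  | mul b b' _ _ hb hb' => rw [mul_assoc, hb, hb', mul_assoc]
  | std x a y b ha hb h => exact coreProj_aligned_mul R ha hb h z

theorem coreProj_mul_right {b : LeavittPathAlgebra R E} (hb : b ∈ core R E)
    (z : LeavittPathAlgebra R E) : coreProj R E (z * b) = coreProj R E z * b := by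
  have hb' : star b ∈ core R E := star_mem hb
  have := coreProj_mul_left R hb' (star z)
  rwa [← star_mul, coreProj_star, coreProj_star, ← star_mul, star_inj] at this

theorem coreProj_of_mem {b : LeavittPathAlgebra R E} (hb : b ∈ core R E) :
    coreProj R E b = b := by
  induction hb using core_induction with
  | zero => simp
  | add b b' _ _ hb hb' => rw [map_add, hb, hb']
  | smul c b _ hb => rw [map_smul, hb]
  | mul b b' _ _ hb hb' =>
    rw [coreProj_mul_left R ‹b ∈ core R E›, hb']
  | std x a y b ha hb h => exact coreProj_of_aligned R ha hb h

end CoreProjection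

/-! ### Positivity through orthogonal decompositions, and uniqueness. -/

section Positivity

variable (R : Type w) [CommRing R] {V : Type u} {D : Type v} {E : DirectedGraph V D}

/-- Let `t = α β*` and `s = (α k) γ*`. Then `t* s = (β k) γ*` is killed unless aligned; if aligned,
it lies in the core and `s = t (t* s)`. The case of a longer first path in `t` follows by the
involution. -/
theorem coreProj_star_mul_eq_zero_or {s t : LeavittPathAlgebra R E} (hs : s ∈ stdGenerators R E)
    (ht : t ∈ stdGenerators R E) : coreProj R E (star t * s) = 0 ∨
      (∃ z ∈ core R E, s = t * z) ∨ ∃ z ∈ core R E, t = s * z := by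
  have key : ∀ {x y z : V} {a b c k : List D}, E.IsChainFrom x (a ++ k) → E.IsChainFrom y b →
      E.endVertex x a = E.endVertex y b → E.IsChainFrom z c →
      E.endVertex x (a ++ k) = E.endVertex z c →
      coreProj R E (star (ofEdges R E x a * star (ofEdges R E y b)) *
        (ofEdges R E x (a ++ k) * star (ofEdges R E z c))) = 0 ∨
      ∃ w ∈ core R E, ofEdges R E x (a ++ k) * star (ofEdges R E z c) =
        ofEdges R E x a * star (ofEdges R E y b) * w := by
    intro x y z a b c k hak hb hab hc hakc
    have ha := (isChainFrom_append _ _ _).1 hak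
    have hbk : E.IsChainFrom y (b ++ k) := (isChainFrom_append _ _ _).2 ⟨hb, hab ▸ ha.2⟩
    have hbkc : E.endVertex y (b ++ k) = E.endVertex z c := by
      rw [← hakc, endVertex_append, endVertex_append, hab]
    by_cases h : E.Aligned y (b ++ k) z c
    · refine .inr ⟨_, Aligned.mem_core R hbk hc h, ?_⟩
      rw [mul_assoc, ← mul_assoc (star (ofEdges R E y b)), star_ofEdges_mul_append R hbk,
        ofEdges_append R hak, hab, mul_assoc]
    · left
      rw [star_mul, star_star, mul_assoc, ← mul_assoc (star (ofEdges R E x a)),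
        star_ofEdges_mul_append R hak, ← mul_assoc, hab, ← ofEdges_append R hbk,
        coreProj_of_not_aligned R hbk hc hbkc h]
  obtain ⟨⟨x, a, ha⟩, ⟨y, b, hb⟩, hab, rfl⟩ := hs
  obtain ⟨⟨x', c, hc⟩, ⟨y', d, hd⟩, hcd, rfl⟩ := ht
  simp only [FinPath.range, ofPath] at *
  by_cases hac : x' = x ∧ (c <+: a ∨ a <+: c)
  · obtain ⟨rfl, ⟨k, rfl⟩ | ⟨k, rfl⟩⟩ := hac
    · exact (key ha hd hcd hb hab).imp_right .inl
    · refine (key hc hb hab hd hcd).imp (fun h => ?_) .inr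
      rw [← star_inj, ← coreProj_star, star_mul, star_star, h, star_zero]
  · left
    rw [star_mul, star_star, mul_assoc, ← mul_assoc (star (ofEdges R E x' c)),
      star_ofEdges_mul_eq_zero R hc ha hac, zero_mul, mul_zero, map_zero]

/-- A substitute for Gram–Schmidt over the core: two generators are orthogonal or one is a core
multiple of the other, so it is enough to discard redundant ones. -/
theorem exists_orthogonal_finset (S : Finset (LeavittPathAlgebra R E))
    (hS : ↑S ⊆ stdGenerators R E) : ∃ T : Finset (LeavittPathAlgebra R E),
      ↑T ⊆ stdGenerators R E ∧
      (∀ t ∈ T, ∀ t' ∈ T, t ≠ t' → coreProj R E (star t * t') = 0) ∧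
      ∀ s ∈ S, ∃ t ∈ T, ∃ z ∈ core R E, s = t * z := by
  classical
  induction S using Finset.induction_on with
  | empty => exact ⟨∅, by simp, by simp, by simp⟩
  | insert s S _ ih =>
    rw [Finset.coe_insert, Set.insert_subset_iff] at hS
    obtain ⟨T, hT, hT', hST⟩ := ih hS.2
    by_cases h : ∃ t ∈ T, ∃ z ∈ core R E, s = t * z
    · refine ⟨T, hT, hT', fun s' hs' => ?_⟩
      rcases Finset.mem_insert.1 hs' with rfl | hs'
      · exact h
      · exact hST s' hs'
    have hss : ∃ z ∈ core R E, s = s * z := by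
      obtain ⟨⟨x, a, ha⟩, ⟨y, b, hb⟩, hab, rfl⟩ := hS.1
      simp only [FinPath.range, ofPath] at *
      refine ⟨_, Aligned.mem_core R hb hb (.refl y b), ?_⟩
      rw [mul_assoc, ← mul_assoc (star (ofEdges R E y b)), star_ofEdges_mul_self R hb,
        ← star_vertex, ← star_mul, ofEdges_mul_vertex R hb]
    -- As `s` is a core multiple of no `t` in `T`, every `t` that is not orthogonal to `s` is a core
    -- multiple of `s`, and `s` may replace it.
    refine ⟨insert s (T.filter fun t => coreProj R E (star t * s) = 0), ?_, ?_, ?_⟩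
    · intro t ht
      rcases Finset.mem_insert.1 ht with rfl | ht
      · exact hS.1
      · exact hT (Finset.mem_filter.1 ht).1
    · intro t ht t' ht' hne
      rcases Finset.mem_insert.1 ht with rfl | ht <;> rcases Finset.mem_insert.1 ht' with rfl | ht'
      · exact absurd rfl hne
      · rw [← star_inj, ← coreProj_star, star_mul, star_star, (Finset.mem_filter.1 ht').2,
          star_zero]
      · exact (Finset.mem_filter.1 ht).2
      · exact hT' t (Finset.mem_filter.1 ht).1 t' (Finset.mem_filter.1 ht').1 hne
    · intro s' hs'
      rcases Finset.mem_insert.1 hs' with rfl | hs'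
      · exact ⟨_, Finset.mem_insert_self _ _, hss⟩
      · obtain ⟨t, ht, z, hz, rfl⟩ := hST s' hs'
        by_cases h0 : coreProj R E (star t * s) = 0
        · exact ⟨t, Finset.mem_insert_of_mem (Finset.mem_filter.2 ⟨ht, h0⟩), z, hz, rfl⟩
        · rcases (coreProj_star_mul_eq_zero_or R hS.1 (hT ht)).resolve_left h0 with h' | h'
          · exact absurd ⟨t, ht, h'⟩ h
          · obtain ⟨z', hz', rfl⟩ := h'
            exact ⟨s, Finset.mem_insert_self _ _, z' * z, mul_mem hz' hz, mul_assoc _ _ _⟩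

theorem exists_orthogonal_decomposition (y : LeavittPathAlgebra R E) :
    ∃ (T : Finset (LeavittPathAlgebra R E)) (z : LeavittPathAlgebra R E → LeavittPathAlgebra R E),
      ↑T ⊆ stdGenerators R E ∧
      (∀ t ∈ T, ∀ t' ∈ T, t ≠ t' → coreProj R E (star t * t') = 0) ∧
      (∀ t, z t ∈ core R E) ∧ y = ∑ t ∈ T, t * z t := by
  classical
  obtain ⟨S, hS, hy⟩ := Submodule.mem_span_finite_of_mem_span (mem_span_stdGenerators R y)
  obtain ⟨T, hT, hT', hST⟩ := exists_orthogonal_finset R S hS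
  suffices h : ∃ z : LeavittPathAlgebra R E → LeavittPathAlgebra R E,
      (∀ t, z t ∈ core R E) ∧ y = ∑ t ∈ T, t * z t from
    h.elim fun z hz => ⟨T, z, hT, hT', hz⟩
  induction hy using Submodule.span_induction with
  | zero => exact ⟨0, fun _ => zero_mem _, by simp⟩
  | add y y' _ _ hy hy' =>
    obtain ⟨z, hz, rfl⟩ := hy
    obtain ⟨z', hz', rfl⟩ := hy'
    exact ⟨z + z', fun t => add_mem (hz t) (hz' t), by simp [mul_add, Finset.sum_add_distrib]⟩
  | smul c y _ hy =>
    obtain ⟨z, hz, rfl⟩ := hy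
    exact ⟨c • z, fun t => SMulMemClass.smul_mem c (hz t), by
      simp [Finset.smul_sum, mul_smul_comm]⟩
  | mem s hs =>
    obtain ⟨t, ht, z, hz, rfl⟩ := hST s hs
    refine ⟨Pi.single t z, fun t' => ?_, ?_⟩
    · by_cases h : t' = t
      · subst h; simpa using hz
      · rw [Pi.single_eq_of_ne h]; exact zero_mem _
    · rw [Finset.sum_eq_single t]
      · simp
      · intro t' _ h
        rw [Pi.single_eq_of_ne h, mul_zero]
      · exact fun h => absurd ht h

variable (E) in
/-- The projection onto the commutative core. -/
noncomputable def coreExpectation : LeavittPathAlgebra R E →ₗ[R] core R E where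
  toFun z := ⟨coreProj R E z, coreProj_mem R z⟩
  map_add' z z' := Subtype.ext (map_add _ z z')
  map_smul' c z := Subtype.ext (map_smul _ c z)

theorem coe_coreExpectation (z : LeavittPathAlgebra R E) :
    (coreExpectation R E z : LeavittPathAlgebra R E) = coreProj R E z := rfl

theorem isAlgPositive_coreExpectation_star_mul (y : LeavittPathAlgebra R E) :
    IsAlgPositive (coreExpectation R E (star y * y)) := by
  obtain ⟨T, z, hT, hT', hz, rfl⟩ := exists_orthogonal_decomposition R y
  have hterm : ∀ t ∈ T, star t * t ∈ core R E ∧ star (star t * t) * (star t * t) = star t * t := by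
    intro t ht
    obtain ⟨⟨x, a, ha⟩, ⟨y, b, hb⟩, hab, rfl⟩ := hT ht
    simp only [FinPath.range, ofPath] at *
    rw [star_mul_std R ha hb hab]
    exact ⟨Aligned.mem_core R hb hb (.refl y b), star_mul_std R hb hb rfl⟩
  -- Positivity is required inside the core, to which `t z_t` need not belong. Since `t* t` is a
  -- projection in the core, `z_t* t* t z_t` is rewritten with `t* t z_t`, which does belong to it.
  have hsum : coreProj R E (star (∑ t ∈ T, t * z t) * ∑ t ∈ T, t * z t) =
      ∑ t ∈ T, star (star t * t * z t) * (star t * t * z t) := by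
    rw [star_sum, Finset.sum_mul_sum, map_sum]
    refine Finset.sum_congr rfl fun t ht => ?_
    rw [map_sum, Finset.sum_eq_single t]
    · have hmem : star (t * z t) * (t * z t) ∈ core R E := by
        rw [star_mul, mul_assoc, ← mul_assoc (star t)]
        exact mul_mem (star_mem (hz t)) (mul_mem (hterm t ht).1 (hz t))
      rw [coreProj_of_mem R hmem, star_mul (star t * t), mul_assoc,
        ← mul_assoc (star (star t * t)), (hterm t ht).2, star_mul]
      simp only [mul_assoc]
    · intro t' ht' hne
      rw [star_mul, mul_assoc, ← mul_assoc (star t), coreProj_mul_left R (star_mem (hz t)),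
        coreProj_mul_right R (hz t'), hT' t ht t' ht' hne.symm, zero_mul, mul_zero]
    · exact fun h => absurd ht h
  have : coreExpectation R E (star (∑ t ∈ T, t * z t) * ∑ t ∈ T, t * z t) =
      ∑ t ∈ T.attach, star (⟨star t.1 * t.1 * z t.1, mul_mem (hterm t.1 t.2).1 (hz t.1)⟩ : core R E) *
        ⟨star t.1 * t.1 * z t.1, mul_mem (hterm t.1 t.2).1 (hz t.1)⟩ := by
    refine Subtype.ext ?_
    rw [coe_coreExpectation, hsum, AddSubmonoidClass.coe_finsetSum, ← Finset.sum_attach]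
    rfl
  rw [this]
  exact sum_mem fun t _ => AddSubmonoid.subset_closure ⟨_, rfl⟩

theorem isCoreExpectation_coreExpectation : IsCoreExpectation (coreExpectation R E) where
  isCondExpectation :=
    { positive := by
        intro a ha
        unfold IsAlgPositive at ha
        induction ha using AddSubmonoid.closure_induction with
        | zero => rw [map_zero]; exact zero_mem _
        | add a b _ _ ha hb => rw [map_add]; exact add_mem ha hb
        | mem a ha =>
          obtain ⟨y, rfl⟩ := ha
          exact isAlgPositive_coreExpectation_star_mul R y
      idempotent := fun a => Subtype.ext (coreProj_of_mem R (coreProj_mem R a))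
      surjective := fun b => ⟨b, Subtype.ext (coreProj_of_mem R b.2)⟩
      left_linear := fun b a => Subtype.ext (coreProj_mul_left R b.2 a) }
  map_normal := fun _ hx => coreProj_of_mem R (NonUnitalAlgebra.subset_adjoin R hx)
  map_not_normal := by
    rintro _ ⟨⟨x, a, ha⟩, ⟨y, b, hb⟩, hab, rfl⟩ hx
    exact coreProj_of_not_aligned R ha hb hab fun h => hx (Aligned.mem_normalGenerators R ha hb h)

theorem IsCoreExpectation.ext {F G : LeavittPathAlgebra R E →ₗ[R] core R E}
    (hF : IsCoreExpectation F) (hG : IsCoreExpectation G) : F = G := by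
  refine LinearMap.ext fun z => ?_
  induction mem_span_stdGenerators R z using Submodule.span_induction with
  | zero => simp
  | add z z' _ _ hz hz' => rw [map_add, map_add, hz, hz']
  | smul c z _ hz => rw [map_smul, map_smul, hz]
  | mem z hz =>
    refine Subtype.ext ?_
    by_cases h : z ∈ normalGenerators R E
    · rw [hF.map_normal z h, hG.map_normal z h]
    · rw [hF.map_not_normal z hz h, hG.map_not_normal z hz h]

end Positivity

/-! ### Corners of path projections whose range reaches no exit. -/

section Compression

variable (R : Type w) [CommRing R] {V : Type u} {D : Type v} {E : DirectedGraph V D}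

theorem proj_mul_proj_of_prefix {x : V} {a c : List D} (h : E.IsChainFrom x (a ++ c)) :
    ofEdges R E x a * star (ofEdges R E x a) *
      (ofEdges R E x (a ++ c) * star (ofEdges R E x (a ++ c))) =
        ofEdges R E x (a ++ c) * star (ofEdges R E x (a ++ c)) := by
  rw [mul_assoc, ← mul_assoc (star (ofEdges R E x a)), star_ofEdges_mul_append R h, ← mul_assoc,
    ← ofEdges_append R h]

theorem star_proj (z : LeavittPathAlgebra R E) : star (z * star z) = z * star z := by
  rw [star_mul, star_star]

theorem proj_mul_proj_of_extends {x : V} {a c : List D} (h : E.IsChainFrom x (a ++ c)) :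
    ofEdges R E x (a ++ c) * star (ofEdges R E x (a ++ c)) *
      (ofEdges R E x a * star (ofEdges R E x a)) =
        ofEdges R E x (a ++ c) * star (ofEdges R E x (a ++ c)) := by
  rw [← star_inj, star_mul, star_proj, star_proj, proj_mul_proj_of_prefix R h]

theorem proj_mul_proj_of_not_comparable {x y : V} {a b : List D} (ha : E.IsChainFrom x a)
    (hb : E.IsChainFrom y b) (h : ¬ (x = y ∧ (a <+: b ∨ b <+: a))) :
    ofEdges R E x a * star (ofEdges R E x a) * (ofEdges R E y b * star (ofEdges R E y b)) = 0 := by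
  rw [mul_assoc, ← mul_assoc (star (ofEdges R E x a)), star_ofEdges_mul_eq_zero R ha hb h,
    zero_mul, mul_zero]

theorem proj_comm {x y : V} {a b : List D} (ha : E.IsChainFrom x a) (hb : E.IsChainFrom y b) :
    ofEdges R E x a * star (ofEdges R E x a) * (ofEdges R E y b * star (ofEdges R E y b)) =
      ofEdges R E y b * star (ofEdges R E y b) * (ofEdges R E x a * star (ofEdges R E x a)) := by
  by_cases h : x = y ∧ (a <+: b ∨ b <+: a)
  · obtain ⟨rfl, ⟨c, rfl⟩ | ⟨c, rfl⟩⟩ := h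
    · rw [proj_mul_proj_of_prefix R hb, proj_mul_proj_of_extends R hb]
    · rw [proj_mul_proj_of_prefix R ha, proj_mul_proj_of_extends R ha]
  · rw [proj_mul_proj_of_not_comparable R ha hb h,
      proj_mul_proj_of_not_comparable R hb ha fun h' => h ⟨h'.1.symm, h'.2.symm⟩]

/-- Without exits, passing to a longer path does not shrink `α α*`, so no path projection cuts it
properly. -/
theorem proj_mul_proj_of_noExits {x y : V} {a b : List D} (ha : E.IsChainFrom x a)
    (hb : E.IsChainFrom y b) (hn : E.NoExits (E.endVertex x a)) :
    ofEdges R E x a * star (ofEdges R E x a) * (ofEdges R E y b * star (ofEdges R E y b)) = 0 ∨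
    ofEdges R E x a * star (ofEdges R E x a) * (ofEdges R E y b * star (ofEdges R E y b)) =
      ofEdges R E x a * star (ofEdges R E x a) := by
  by_cases h : x = y ∧ (a <+: b ∨ b <+: a)
  · right
    obtain ⟨rfl, ⟨c, rfl⟩ | ⟨c, rfl⟩⟩ := h
    · rw [proj_mul_proj_of_prefix R hb, proj_append_of_noExits R hn hb]
    · rw [proj_mul_proj_of_extends R ha]
  · exact .inl (proj_mul_proj_of_not_comparable R ha hb h)

/-- For an aligned generator `u = α β*` with `α ≠ β`, put `p = α α* = β β*`, so that `u = u p = p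
u`. With `q = γ γ*`, the product `p q` is `0` or `p`, and `u q` and `q u` are both `0` or both `u`.
For `α = β`, path projections commute. -/
theorem core_mul_proj_comm {y : V} {c : List D} (hc : E.IsChainFrom y c)
    {z : LeavittPathAlgebra R E} (hz : z ∈ core R E) :
    z * (ofEdges R E y c * star (ofEdges R E y c)) =
      ofEdges R E y c * star (ofEdges R E y c) * z := by
  induction hz using core_induction with
  | zero => simp
  | add z z' _ _ hz hz' => rw [add_mul, mul_add, hz, hz']
  | smul r z _ hz => rw [smul_mul_assoc, mul_smul_comm, hz]
  | mul z z' _ _ hz hz' => rw [mul_assoc, hz', ← mul_assoc, hz, mul_assoc]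
  | std x a x' b ha hb h =>
    have hq := Aligned.mul_star_eq R ha hb h
    obtain ⟨rfl, hab, rfl | ⟨hn, -⟩⟩ := h
    · exact proj_comm R ha hc
    have hr : ofEdges R E x a * star (ofEdges R E x b) *
        (ofEdges R E x b * star (ofEdges R E x b)) =
        ofEdges R E x a * star (ofEdges R E x b) := by
      rw [mul_assoc, ← mul_assoc (star (ofEdges R E x b)), star_ofEdges_mul_self R hb,
        ← mul_assoc, ← hab, ofEdges_mul_vertex R ha]
    have hl : ofEdges R E x b * star (ofEdges R E x b) *
        (ofEdges R E x a * star (ofEdges R E x b)) =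
        ofEdges R E x a * star (ofEdges R E x b) := by
      rw [← hq, mul_assoc, ← mul_assoc (star (ofEdges R E x a)), star_ofEdges_mul_self R ha,
        ← mul_assoc, ofEdges_mul_vertex R ha]
    conv_lhs => rw [← hr, mul_assoc]
    conv_rhs => rw [← hl, ← mul_assoc, ← proj_comm R hb hc]
    rcases proj_mul_proj_of_noExits R hb hc (hab ▸ hn) with h0 | h0
    · rw [h0, mul_zero, zero_mul]
    · rw [h0, hr, hl]

/-- `α (γ δ*) α*` is zero or `(α γ)(α δ)*`; in the latter case `γ` and `δ` start at a vertex that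
reaches no exit, so they are comparable and `α γ`, `α δ` are aligned. -/
theorem proj_mul_mul_proj_mem_core {x : V} {a : List D} (ha : E.IsChainFrom x a)
    (hn : E.NoExits (E.endVertex x a)) (z : LeavittPathAlgebra R E) :
    ofEdges R E x a * star (ofEdges R E x a) * z * (ofEdges R E x a * star (ofEdges R E x a)) ∈
      core R E := by
  have key : ∀ w, ofEdges R E x a * w * star (ofEdges R E x a) ∈ core R E := by
    intro w
    induction w using std_induction with
    | zero => simp
    | add w w' hw hw' => rw [mul_add, add_mul]; exact add_mem hw hw'
    | smul r w hw => rw [mul_smul_comm, smul_mul_assoc]; exact SMulMemClass.smul_mem r hw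
    | std y c y' d hc hd hcd =>
      rw [mul_assoc, mul_assoc, ← star_mul, ← mul_assoc]
      by_cases hy : E.endVertex x a = y
      · by_cases hy' : E.endVertex x a = y'
        · subst hy
          subst hy'
          have hac := (isChainFrom_append _ _ _).2 ⟨ha, hc⟩
          have had := (isChainFrom_append _ _ _).2 ⟨ha, hd⟩
          rw [← ofEdges_append R hac, ← ofEdges_append R had]
          refine Aligned.mem_core R hac had ⟨rfl, ?_, .inr ⟨?_, ?_⟩⟩
          · rw [endVertex_append, endVertex_append, hcd]
          · rw [endVertex_append]; exact hn.endVertex hc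
          · simpa [List.prefix_append_right_inj] using hn.prefix_or_prefix hc hd
        · rw [← ofEdges_mul_vertex R ha, mul_assoc _ _ (ofEdges R E y' d),
            vertex_mul_ofEdges_of_ne R hy' hd, mul_zero, star_zero, mul_zero]
          exact zero_mem _
      · rw [← ofEdges_mul_vertex R ha, mul_assoc _ _ (ofEdges R E y c),
          vertex_mul_ofEdges_of_ne R hy hc, mul_zero, zero_mul]
        exact zero_mem _
  have := key (star (ofEdges R E x a) * z * ofEdges R E x a)
  simpa only [mul_assoc] using this

theorem proj_mul_mul_proj {x : V} {a : List D} (ha : E.IsChainFrom x a)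
    (hn : E.NoExits (E.endVertex x a)) (z : LeavittPathAlgebra R E) :
    ofEdges R E x a * star (ofEdges R E x a) * z * (ofEdges R E x a * star (ofEdges R E x a)) =
      coreProj R E z * (ofEdges R E x a * star (ofEdges R E x a)) := by
  have hp : ofEdges R E x a * star (ofEdges R E x a) ∈ core R E :=
    Aligned.mem_core R ha ha (.refl x a)
  rw [← coreProj_of_mem R (proj_mul_mul_proj_mem_core R ha hn z), coreProj_mul_right R hp,
    coreProj_mul_left R hp, ← core_mul_proj_comm R ha (coreProj_mem R z), mul_assoc]
  have := star_mul_std R ha ha rfl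
  rw [star_proj] at this
  rw [this]

end Compression

end LeavittPathAlgebra

/-! ### Essential heads of discrete trails reach no exit. -/

namespace DirectedGraph

variable {V : Type u} {D : Type v} {E : DirectedGraph V D}

theorem IsSink.noExits {x : V} (h : E.IsSink x) : E.NoExits x := by
  intro c hc e f he _
  cases c with
  | nil => exact absurd he (h e)
  | cons e' c => exact absurd hc.1 (h e')

theorem endVertex_segmentEdges {t : ℕ → D} (ht : E.IsInfinitePath t) (j k : ℕ) :
    E.endVertex (E.source (t j)) (segmentEdges t j k) = E.source (t (j + k)) := by
  induction k generalizing j with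
  | zero => rfl
  | succ k ih =>
    rw [segmentEdges, endVertex, ht j, ih (j + 1)]
    congr 2
    omega

theorem mem_segmentEdges {t : ℕ → D} {j k n : ℕ} (hjn : j ≤ n) (hnk : n < j + k) :
    t n ∈ segmentEdges t j k := by
  induction k generalizing j with
  | zero => omega
  | succ k ih =>
    rw [segmentEdges, List.mem_cons]
    rcases hjn.eq_or_lt with rfl | h
    · exact .inl rfl
    · exact .inr (ih h (by omega))

theorem RepeatsFrom.mem_segmentEdges {t : ℕ → D} {j k : ℕ} (h : RepeatsFrom t j k) {n : ℕ}
    (hn : j ≤ n) : t n ∈ segmentEdges t j k := by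
  induction n using Nat.strong_induction_on with
  | _ n ih =>
    by_cases hnk : n < j + k
    · exact DirectedGraph.mem_segmentEdges hn hnk
    · have hk := h.1
      have := h.2 (n - k) (by omega)
      rw [Nat.sub_add_cancel (by omega)] at this
      rw [this]
      exact ih (n - k) (by omega) (by omega)

/-- Every edge `t n` with `n ≥ j` occurs in the period, so it is the only edge leaving its source,
and each path from `s(t j)` has to follow `t`. -/
theorem RepeatsFrom.noExits {t : ℕ → D} (ht : E.IsInfinitePath t) {j k : ℕ}
    (h : RepeatsFrom t j k) (hexit : ¬ (segment ht j k).HasExit) : E.NoExits (E.source (t j)) := by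
  have huniq : ∀ n, j ≤ n → ∀ f, E.source f = E.source (t n) → f = t n := by
    intro n hn f hf
    by_contra hne
    exact hexit ⟨t n, h.mem_segmentEdges hn, f, hf, hne⟩
  have key : ∀ c n, j ≤ n → E.IsChainFrom (E.source (t n)) c →
      ∃ m, j ≤ m ∧ E.endVertex (E.source (t n)) c = E.source (t m) := by
    intro c
    induction c with
    | nil => exact fun n hn _ => ⟨n, hn, rfl⟩
    | cons e c ih =>
      rintro n hn ⟨he, hc⟩
      obtain rfl := huniq n hn e he
      rw [ht n] at hc
      rw [endVertex, ht n]
      exact ih (n + 1) (by omega) hc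
  intro c hc e f he hf
  obtain ⟨m, hm, hcm⟩ := key c j le_rfl hc
  rw [hcm] at he hf
  rw [huniq m hm e he, huniq m hm f hf]

theorem Trail.noExits_range_essHead (τ : E.Trail) (hτ : τ.IsDiscrete) :
    E.NoExits (τ.essHead hτ).range := by
  cases τ with
  | finite μ h => exact h.noExits
  | infinite t ht =>
    obtain ⟨k, hk, hexit⟩ := hτ.choose_spec
    have := hk.1.noExits ht hexit
    -- With indices starting at `0`, the head has length `j` and ends at `s(t j)`, where the period
    -- begins.
    change E.NoExits (E.endVertex (E.source (t 0)) (segmentEdges t 0 hτ.choose))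
    rwa [endVertex_segmentEdges ht, Nat.zero_add]

end DirectedGraph

end

theorem mainTheorem12 {R : Type w} [CommRing R] {V : Type u} {D : Type v}
    (E : DirectedGraph V D) :
    ∃ EM : LeavittPathAlgebra R E →ₗ[R] LeavittPathAlgebra.core R E,
      LeavittPathAlgebra.IsCoreExpectation EM ∧
      (∀ F : LeavittPathAlgebra R E →ₗ[R] LeavittPathAlgebra.core R E,
        LeavittPathAlgebra.IsCoreExpectation F → F = EM) ∧
      ∀ (x : LeavittPathAlgebra R E) (τ : E.Trail) (hτ : τ.IsDiscrete),
        (LeavittPathAlgebra.ofPath R (τ.essHead hτ) *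
            star (LeavittPathAlgebra.ofPath R (τ.essHead hτ))) * x *
          (LeavittPathAlgebra.ofPath R (τ.essHead hτ) *
            star (LeavittPathAlgebra.ofPath R (τ.essHead hτ))) =
        (EM x : LeavittPathAlgebra R E) *
          (LeavittPathAlgebra.ofPath R (τ.essHead hτ) *
            star (LeavittPathAlgebra.ofPath R (τ.essHead hτ))) := by
  refine ⟨LeavittPathAlgebra.coreExpectation R E,
    LeavittPathAlgebra.isCoreExpectation_coreExpectation R, fun F hF =>
      hF.ext R (LeavittPathAlgebra.isCoreExpectation_coreExpectation R), fun x τ hτ => ?_⟩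
  exact LeavittPathAlgebra.proj_mul_mul_proj R (τ.essHead hτ).chain
    (τ.noExits_range_essHead hτ) x
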